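/- For $N\in\mathbb C\setminus\{0\}$ let $\mathsf{NCBipart}_N$ be the $\mathbb C$-linear strict monoidal category with objects $0,1,2,\dots$ (tensor product of objects is addition) given by the following generators and relations. Generators: for all $k,l\ge 0$ a black spider $T_{k,l}\colon k\to l$ and a white spider $\tilde T_{k,l}\colon k\to l$. Relations: $T_{0,0}=N\,\mathrm{id}_0$; $T_{1,1}=\mathrm{id}_1$; for all $k_1,k_2,l_1,l_2\ge 0$ and $m\ge 1$ $$(T_{k_1+m,\,l_1}\otimes\mathrm{id}_{l_2})(\mathrm{id}_{k_1}\otimes T_{k_2,\,m+l_2})=T_{k_1+k_2,\,l_1+l_2};$$ the same relations for the white spiders; $T_{2,0}=\tilde T_{2,0}$; $T_{2,1}\tilde T_{1,2}=\frac1N T_{0,1}\tilde T_{1,0}$; and all relations obtained from these by the reflection $\dagger$, which reverses composition, preserves tensor products and exchanges $T_{k,l}$ with $T_{l,k}$ and $\tilde T_{k,l}$ with $\tilde T_{l,k}$. Let $\mathsf{NCBipartEven}_N\subset\mathsf{NCBipart}_N$ be the subcategory (closed under linear combinations, composition, tensor product and reflection) generated by $T_{2,2}$, $\tilde T_{2,2}$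 and $T_{2,0}$. Denote by $C_n=\frac1{n+1}\binom{2n}{n}$ the Catalan numbers. Then for every complex number $\delta\ne0$ and all $k,l\in\mathbb N_0$, $$\dim_{\mathbb C}\mathsf{NCBipartEven}_{\delta^2}(k,l)=\begin{cases}C_{(k+l)/2}^2&\text{if $k+l$ is even,}\\0&\text{if $k+l$ is odd.}\end{cases}$$ -/

import Mathlib

namespace Spiders

/-- The two kinds of spiders. -/
inductive Colour : Type
  | black
  | white

/-- Formal planar diagrams with `k` inputs and `l` outputs: terms built from strings and from black
and white spiders by composition (in diagrammatic order, `comp f g` is `f` followed by `g`) and by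
tensor product (juxtaposition). There is no crossing among the generators. -/
inductive Diagram : ℕ → ℕ → Type
  /-- `n` parallel strings -/
  | id (n : ℕ) : Diagram n n
  /-- the spider with `k` inputs and `l` outputs -/
  | spider (c : Colour) (k l : ℕ) : Diagram k l
  | comp {k l m : ℕ} (f : Diagram k l) (g : Diagram l m) : Diagram k m
  | tensor {k l k' l' : ℕ} (f : Diagram k l) (g : Diagram k' l') : Diagram (k + k') (l + l')

namespace Diagram

/-- Transport of a diagram along equalities between the numbers of inputs and outputs. -/
def cast {k l k' l' : ℕ} (hk : k = k') (hl : l = l') (f : Diagram k l) : Diagram k' l' :=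
  hk ▸ hl ▸ f

/-- The involution on diagrams: reflection along the horizontal axis. -/
def flip : {k l : ℕ} → Diagram k l → Diagram l k
  | _, _, id n => id n
  | _, _, spider c k l => spider c l k
  | _, _, comp f g => comp g.flip f.flip
  | _, _, tensor f g => tensor f.flip g.flip

/-- The cap `2 → 0`; its reflection is the cup `0 → 2`. The relation `Rel.pair` below says that the
white spider could be used as well. -/
def pair : Diagram 2 0 := spider Colour.black 2 0

end Diagram

open Diagram in
/-- The relations of the category of non-crossing complementary spiders with parameter `N`:
`Rel N a f g` stands for the relation `f = a • g`. -/
inductive Rel (N : ℂ) : {k l : ℕ} → ℂ → Diagram k l → Diagram k l → Prop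
  -- axioms of a strict monoidal category
  | id_comp {k l : ℕ} (f : Diagram k l) : Rel N 1 (comp (id k) f) f
  | comp_id {k l : ℕ} (f : Diagram k l) : Rel N 1 (comp f (id l)) f
  | comp_assoc {k l m n : ℕ} (f : Diagram k l) (g : Diagram l m) (h : Diagram m n) :
      Rel N 1 (comp (comp f g) h) (comp f (comp g h))
  | id_tensor_id (m n : ℕ) : Rel N 1 (tensor (id m) (id n)) (id (m + n))
  | interchange {k l m k' l' m' : ℕ} (f : Diagram k l) (g : Diagram l m)
      (f' : Diagram k' l') (g' : Diagram l' m') :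
      Rel N 1 (tensor (comp f g) (comp f' g')) (comp (tensor f f') (tensor g g'))
  | tensor_assoc {k₁ l₁ k₂ l₂ k₃ l₃ : ℕ} (f : Diagram k₁ l₁) (g : Diagram k₂ l₂)
      (h : Diagram k₃ l₃) :
      Rel N 1 ((tensor (tensor f g) h).cast (Nat.add_assoc k₁ k₂ k₃) (Nat.add_assoc l₁ l₂ l₃))
        (tensor f (tensor g h))
  | unit_tensor {k l : ℕ} (f : Diagram k l) :
      Rel N 1 ((tensor (id 0) f).cast (Nat.zero_add k) (Nat.zero_add l)) f
  | tensor_unit {k l : ℕ} (f : Diagram k l) :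
      Rel N 1 ((tensor f (id 0)).cast (Nat.add_zero k) (Nat.add_zero l)) f
  -- relations between spiders of one colour: value of the isolated point; a spider with one input
  -- and one output is a string (in view of `fuse`, this is the snake equation for cup and cap);
  -- fusion of two spiders joined by `m ≥ 1` strings
  | isolated (c : Colour) : Rel N N (spider c 0 0) (id 0)
  | string (c : Colour) : Rel N 1 (spider c 1 1) (id 1)
  | fuse (c : Colour) (k₁ l₁ k₂ l₂ m : ℕ) (hm : 1 ≤ m) :
      Rel N 1
        (comp (tensor (id k₁) (spider c k₂ (m + l₂)))
          ((tensor (spider c (k₁ + m) l₁) (id l₂)).cast (Nat.add_assoc k₁ m l₂) rfl))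
        (spider c (k₁ + k₂) (l₁ + l₂))
  -- relations between the two colours
  | pair : Rel N 1 (spider Colour.black 2 0) (spider Colour.white 2 0)
  | double_edge :
      Rel N N⁻¹ (comp (spider Colour.white 1 2) (spider Colour.black 2 1))
        (comp (spider Colour.white 1 0) (spider Colour.black 0 1))
  -- closure under reflection, composition and tensor product
  | flip {k l : ℕ} {a : ℂ} {f g : Diagram k l} : Rel N a f g → Rel N a f.flip g.flip
  | comp_left {k l m : ℕ} {a : ℂ} {f f' : Diagram k l} (g : Diagram l m) :
      Rel N a f f' → Rel N a (comp f g) (comp f' g)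
  | comp_right {k l m : ℕ} {a : ℂ} (f : Diagram k l) {g g' : Diagram l m} :
      Rel N a g g' → Rel N a (comp f g) (comp f g')
  | tensor_left {k l k' l' : ℕ} {a : ℂ} {f f' : Diagram k l} (g : Diagram k' l') :
      Rel N a f f' → Rel N a (tensor f g) (tensor f' g)
  | tensor_right {k l k' l' : ℕ} {a : ℂ} (f : Diagram k l) {g g' : Diagram k' l'} :
      Rel N a g g' → Rel N a (tensor f g) (tensor f g')

/-- The subspace of formal linear combinations of diagrams generated by the relations. -/
noncomputable def relations (N : ℂ) (k l : ℕ) : Submodule ℂ (Diagram k l →₀ ℂ) :=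
  Submodule.span ℂ
    {x | ∃ (a : ℂ) (f g : Diagram k l), Rel N a f g ∧
      x = Finsupp.single f 1 - a • Finsupp.single g 1}

/-- The morphism space `NCBipart_N(k, l)` of the abstract category of non-crossing complementary
spiders. -/
abbrev NCBipart (N : ℂ) (k l : ℕ) : Type :=
  (Diagram k l →₀ ℂ) ⧸ relations N k l

/-- The morphism represented by a diagram. -/
noncomputable def NCBipart.of (N : ℂ) {k l : ℕ} (f : Diagram k l) : NCBipart N k l :=
  (relations N k l).mkQ (Finsupp.single f 1)

/-- The diagrams obtained from strings, the black and the white spider with two inputs and two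
outputs, and the cap, by composition, tensor product and reflection. -/
inductive IsEvenDiagram : {k l : ℕ} → Diagram k l → Prop
  | id (n : ℕ) : IsEvenDiagram (Diagram.id n)
  | connecter (c : Colour) : IsEvenDiagram (Diagram.spider c 2 2)
  | pair : IsEvenDiagram Diagram.pair
  | comp {k l m : ℕ} {f : Diagram k l} {g : Diagram l m} :
      IsEvenDiagram f → IsEvenDiagram g → IsEvenDiagram (Diagram.comp f g)
  | tensor {k l k' l' : ℕ} {f : Diagram k l} {g : Diagram k' l'} :
      IsEvenDiagram f → IsEvenDiagram g → IsEvenDiagram (Diagram.tensor f g)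
  | flip {k l : ℕ} {f : Diagram k l} : IsEvenDiagram f → IsEvenDiagram f.flip

/-- The morphism space `NCBipartEven_N(k, l)` of the subcategory of `NCBipart_N` generated by the
black and the white spider with two inputs and two outputs and by the cap. -/
noncomputable def NCBipartEven (N : ℂ) (k l : ℕ) : Submodule ℂ (NCBipart N k l) :=
  Submodule.span ℂ {x | ∃ f : Diagram k l, IsEvenDiagram f ∧ x = NCBipart.of N f}

end Spiders

/-!
By the snake relations the inputs of a morphism can be bent around to become outputs (`bendEquiv`),
so only the morphisms `0 → m` matter, and these vanish for odd `m`.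

On the morphisms `0 → 2 n` there act two commuting Temperley-Lieb algebras with loop parameter `δ`
(`isTemperleyLieb_tl`, `commute_tl_swap`): the generator at position `i` is `δ` times a connecter
on the outputs `i, i + 1`, black at even and white at odd positions for one of the algebras, and
the other way round for the other. This is the usual picture in which every string is doubled to a
pair of lines, each algebra acting on one line of every string. The two algebras generate, from the
comb of `n` cups, the images of pairs of noncrossing pairings.

The rewriting rules of the Temperley-Lieb algebra bring every product of generators applied to the
comb into a normal form, given by a list that encodes a noncrossing pairing
(`IsTemperleyLieb.exists_apply_word`). A cup inserted at any place comes from a cup at the end,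
moved by both algebras, and a cap absorbs a generator of each algebra, so that the span of the
canonical morphisms `pairVec`, which are indexed by pairs of normal forms, is stable under all even
diagrams (`act_mem_pairFamilies`). This gives the upper bound.

For the lower bound the category is represented at the parameter `16` by matrices with rational
entries (`eval`): the black spider is given by the structure maps of the algebra of `4 × 4`
matrices, the white spider by those of the opposite algebra. Relations with the factor `N ^ j`
become relations with the factor `16 ^ j` (`eval_rel`). As the labels of the lines form a vector
space over the field with two elements, a diagram is mapped to a power of two times the indicator
function of a linear relation, so that its support together with the exponent, in which `2` may be
replaced by a fourth root of `N`, is an invariant with values in a free vector space for every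
`N ≠ 0` (`supportMap`). The support of a canonical morphism is the set of labellings whose lines are
constant on the arcs of its two pairings (`hasLines_pairVec`). These supports are different, and
hence the canonical morphisms are linearly independent.

Finally the normal forms are counted by ballot numbers (`encard_normalForms`), which gives the
Catalan number.
-/

namespace Spiders

open Diagram

/-! ### Diagrams as operators on families of morphisms -/

section

variable {N : ℂ}

theorem NCBipart.of_rel {k l : ℕ} {a : ℂ} {f g : Diagram k l} (h : Rel N a f g) :
    NCBipart.of N f = a • NCBipart.of N g := by
  rw [← sub_eq_zero, NCBipart.of, NCBipart.of, ← map_smul, ← map_sub, Submodule.mkQ_apply,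
    Submodule.Quotient.mk_eq_zero]
  exact Submodule.subset_span ⟨a, f, g, h, rfl⟩

theorem NCBipart.of_eq_of_rel {k l : ℕ} {f g : Diagram k l} (h : Rel N 1 f g) :
    NCBipart.of N f = NCBipart.of N g := by
  rw [NCBipart.of_rel h, one_smul]

/-- The linear map on a morphism space determined by values on diagrams that respect the
relations. -/
noncomputable def NCBipart.lift {k l : ℕ} {V : Type*} [AddCommGroup V] [Module ℂ V]
    (φ : Diagram k l → V) (h : ∀ a f g, Rel N a f g → φ f = a • φ g) : NCBipart N k l →ₗ[ℂ] V :=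
  (relations N k l).liftQ (Finsupp.linearCombination ℂ φ) (by
    rw [relations, Submodule.span_le]
    rintro x ⟨a, f, g, hr, rfl⟩
    simp [h a f g hr])

@[simp]
theorem NCBipart.lift_of {k l : ℕ} {V : Type*} [AddCommGroup V] [Module ℂ V]
    (φ : Diagram k l → V) (h : ∀ a f g, Rel N a f g → φ f = a • φ g) (f : Diagram k l) :
    NCBipart.lift φ h (NCBipart.of N f) = φ f := by
  simp [NCBipart.lift, NCBipart.of]

theorem NCBipart.span_of (k l : ℕ) :
    Submodule.span ℂ (Set.range (NCBipart.of N (k := k) (l := l))) = ⊤ := by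
  have h : Set.range (NCBipart.of N (k := k) (l := l)) =
      (relations N k l).mkQ '' Set.range (fun f => Finsupp.single f (1 : ℂ)) := by
    rw [← Set.range_comp]; rfl
  rw [h, ← Submodule.map_span]
  have h2 : Submodule.span ℂ (Set.range (fun f : Diagram k l => Finsupp.single f (1 : ℂ))) = ⊤ := by
    have := (Finsupp.basisSingleOne (R := ℂ) (ι := Diagram k l)).span_eq
    rwa [Finsupp.coe_basisSingleOne] at this
  rw [h2, Submodule.map_top, Submodule.range_mkQ]

theorem NCBipart.hom_ext {k l : ℕ} {V : Type*} [AddCommGroup V] [Module ℂ V]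
    {φ ψ : NCBipart N k l →ₗ[ℂ] V} (h : ∀ f, φ (NCBipart.of N f) = ψ (NCBipart.of N f)) :
    φ = ψ := by
  apply LinearMap.ext_on_range (NCBipart.span_of k l) h

/-- Composition with a fixed diagram `d` after the argument. -/
noncomputable def post (N : ℂ) (k : ℕ) {l m : ℕ} (d : Diagram l m) :
    NCBipart N k l →ₗ[ℂ] NCBipart N k m :=
  NCBipart.lift (fun f => NCBipart.of N (f.comp d))
    fun _ _ _ h => NCBipart.of_rel (h.comp_left d)

@[simp]
theorem post_of {k l m : ℕ} (d : Diagram l m) (f : Diagram k l) :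
    post N k d (NCBipart.of N f) = NCBipart.of N (f.comp d) := NCBipart.lift_of _ _ _

theorem of_comp_smul_congr {k l m : ℕ} {f f' : Diagram k l} {g g' : Diagram l m} {a b : ℂ}
    (hf : NCBipart.of N f = a • NCBipart.of N f') (hg : NCBipart.of N g = b • NCBipart.of N g') :
    NCBipart.of N (f.comp g) = (a * b) • NCBipart.of N (f'.comp g') := by
  have h1 : NCBipart.of N (f.comp g) = a • NCBipart.of N (f'.comp g) := by
    rw [← post_of, hf, map_smul, post_of]
  have h2 := congrArg (NCBipart.lift (N := N) (fun d => NCBipart.of N (f'.comp d))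
    fun _ _ _ h => NCBipart.of_rel (h.comp_right f')) hg
  rw [map_smul, NCBipart.lift_of, NCBipart.lift_of] at h2
  rw [h1, h2, smul_smul]

theorem of_tensor_smul_congr {k l k' l' : ℕ} {f f' : Diagram k l} {g g' : Diagram k' l'} {a b : ℂ}
    (hf : NCBipart.of N f = a • NCBipart.of N f') (hg : NCBipart.of N g = b • NCBipart.of N g') :
    NCBipart.of N (f.tensor g) = (a * b) • NCBipart.of N (f'.tensor g') := by
  have h1 := congrArg (NCBipart.lift (N := N) (fun d => NCBipart.of N (d.tensor g))
    fun _ _ _ h => NCBipart.of_rel (h.tensor_left g)) hf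
  rw [map_smul, NCBipart.lift_of, NCBipart.lift_of] at h1
  have h2 := congrArg (NCBipart.lift (N := N) (fun d => NCBipart.of N (f'.tensor d))
    fun _ _ _ h => NCBipart.of_rel (h.tensor_right f')) hg
  rw [map_smul, NCBipart.lift_of, NCBipart.lift_of] at h2
  rw [h1, h2, smul_smul]

theorem post_smul_congr {k l m : ℕ} {d d' : Diagram l m} {a : ℂ}
    (h : NCBipart.of N d = a • NCBipart.of N d') : post N k d = a • post N k d' := by
  apply NCBipart.hom_ext
  intro f
  rw [post_of, LinearMap.smul_apply, post_of,
    of_comp_smul_congr (one_smul ℂ (NCBipart.of N f)).symm h, one_mul]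

/-- Two diagrams, with possibly only propositionally equal numbers of inputs and outputs, represent
the same morphism. -/
def Equ (N : ℂ) {k l k' l' : ℕ} (f : Diagram k l) (g : Diagram k' l') : Prop :=
  ∃ (hk : k = k') (hl : l = l'), NCBipart.of N (f.cast hk hl) = NCBipart.of N g

namespace Equ

theorem of_rel {k l : ℕ} {f g : Diagram k l} (h : Rel N 1 f g) : Equ N f g :=
  ⟨rfl, rfl, NCBipart.of_eq_of_rel h⟩

theorem of_rel_cast {k l k' l' : ℕ} {f : Diagram k l} {g : Diagram k' l'} (hk : k = k')
    (hl : l = l') (h : Rel N 1 (f.cast hk hl) g) : Equ N f g :=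
  ⟨hk, hl, NCBipart.of_eq_of_rel h⟩

theorem refl {k l : ℕ} (f : Diagram k l) : Equ N f f := ⟨rfl, rfl, rfl⟩

theorem cast {k l k' l' : ℕ} (hk : k = k') (hl : l = l') (f : Diagram k l) :
    Equ N (f.cast hk hl) f := by
  subst hk hl; exact refl f

theorem symm {k l k' l' : ℕ} {f : Diagram k l} {g : Diagram k' l'} (h : Equ N f g) : Equ N g f := by
  obtain ⟨rfl, rfl, h⟩ := h; exact ⟨rfl, rfl, h.symm⟩

theorem trans {k l k' l' k'' l'' : ℕ} {f : Diagram k l} {g : Diagram k' l'} {h : Diagram k'' l''}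
    (h1 : Equ N f g) (h2 : Equ N g h) : Equ N f h := by
  obtain ⟨rfl, rfl, h1⟩ := h1
  obtain ⟨rfl, rfl, h2⟩ := h2
  exact ⟨rfl, rfl, h1.trans h2⟩

theorem comp {k l m k' l' m' : ℕ} {f : Diagram k l} {g : Diagram l m} {f' : Diagram k' l'}
    {g' : Diagram l' m'} (h1 : Equ N f f') (h2 : Equ N g g') : Equ N (f.comp g) (f'.comp g') := by
  obtain ⟨rfl, rfl, h1⟩ := h1
  obtain ⟨_, rfl, h2⟩ := h2
  refine ⟨rfl, rfl, ?_⟩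
  have := of_comp_smul_congr (h1.trans (one_smul ℂ _).symm) (h2.trans (one_smul ℂ _).symm)
  rw [one_mul, one_smul] at this
  exact this

theorem tensor {k l k' l' p q p' q' : ℕ} {f : Diagram k l} {g : Diagram p q} {f' : Diagram k' l'}
    {g' : Diagram p' q'} (h1 : Equ N f f') (h2 : Equ N g g') :
    Equ N (f.tensor g) (f'.tensor g') := by
  obtain ⟨rfl, rfl, h1⟩ := h1
  obtain ⟨rfl, rfl, h2⟩ := h2
  refine ⟨rfl, rfl, ?_⟩
  have := of_tensor_smul_congr (h1.trans (one_smul ℂ _).symm) (h2.trans (one_smul ℂ _).symm)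
  rw [one_mul, one_smul] at this
  exact this

theorem assoc {k₁ l₁ k₂ l₂ k₃ l₃ : ℕ} (f : Diagram k₁ l₁) (g : Diagram k₂ l₂)
    (h : Diagram k₃ l₃) : Equ N ((f.tensor g).tensor h) (f.tensor (g.tensor h)) :=
  of_rel_cast _ _ (Rel.tensor_assoc f g h)

theorem of_eq {k l : ℕ} {f g : Diagram k l} (h : Equ N f g) :
    NCBipart.of N f = NCBipart.of N g := by
  obtain ⟨_, _, h⟩ := h; exact h

end Equ

/-- The diagram `g` placed between `i` strings on its left and `b` strings on its right. -/
def layer (i : ℕ) {p q : ℕ} (g : Diagram p q) (b : ℕ) : Diagram (i + p + b) (i + q + b) :=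
  ((Diagram.id i).tensor g).tensor (Diagram.id b)

/-- All morphisms with `k` inputs at once: families of morphisms `k → m`, one for every number `m`
of outputs. -/
abbrev Family (N : ℂ) (k : ℕ) : Type := ∀ m, NCBipart N k m

-- Shortcut instances: the search through the quotients by the relations is slow.
noncomputable instance (N : ℂ) (k : ℕ) : Module ℂ (Family N k) := inferInstance

noncomputable instance (N : ℂ) (k : ℕ) : Algebra ℂ (Module.End ℂ (Family N k)) := inferInstance

/-- Composition of `g` onto the outputs `i, i + 1, …` of the members of a family. It is zero where
there are too few outputs. Composition and tensor product of diagrams turn into products of such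
operators, so that all the transports between `(i + p) + b` and `i + (p + b)` disappear. -/
noncomputable def act (N : ℂ) (k : ℕ) {p q : ℕ} (g : Diagram p q) (i : ℕ) :
    Module.End ℂ (Family N k) :=
  LinearMap.pi fun m => if h : i + q ≤ m then
    (post N k ((layer i g (m - (i + q))).cast rfl (Nat.add_sub_cancel' h))) ∘ₗ
      LinearMap.proj (i + p + (m - (i + q))) else 0

theorem act_apply_of_lt {k p q : ℕ} (g : Diagram p q) {i m : ℕ} (h : m < i + q) (x : Family N k) :
    act N k g i x m = 0 := by
  simp [act, Nat.not_le.2 h]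

theorem act_apply {k p q : ℕ} (g : Diagram p q) (i b : ℕ) {m m' : ℕ} (hm : i + p + b = m)
    (hm' : i + q + b = m') (x : Family N k) :
    act N k g i x m' = post N k ((layer i g b).cast hm hm') (x m) := by
  obtain ⟨c, hc⟩ : ∃ c, c = m' - (i + q) := ⟨_, rfl⟩
  have hcb : c = b := by omega
  have h : i + q ≤ m' := by omega
  simp only [act, LinearMap.pi_apply, h, dif_pos, LinearMap.comp_apply, LinearMap.proj_apply]
  have key : ∀ (c : ℕ) (e : i + q + c = m') (hcb : c = b),
      post N k ((layer i g c).cast rfl e) (x (i + p + c)) =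
        post N k ((layer i g b).cast hm hm') (x m) := by
    intro c e hcb
    subst hcb hm
    rfl
  exact key _ _ (by omega)

theorem post_comp_apply {k l m n : ℕ} (d : Diagram l m) (d' : Diagram m n) (x : NCBipart N k l) :
    post N k (d.comp d') x = post N k d' (post N k d x) := by
  have : post N k (d.comp d') = post N k d' ∘ₗ post N k d := by
    apply NCBipart.hom_ext
    intro f
    simp only [post_of, LinearMap.comp_apply]
    exact (NCBipart.of_eq_of_rel (Rel.comp_assoc f d d')).symm
  rw [this]; rfl

theorem post_congr {k l m : ℕ} {d d' : Diagram l m} (h : Equ N d d') :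
    post N k d = post N k d' := by
  have := post_smul_congr (k := k) (h.of_eq.trans (one_smul ℂ _).symm)
  rwa [one_smul] at this

theorem Equ.layer_comp {p q r : ℕ} (f : Diagram p q) (g : Diagram q r) (i b : ℕ) :
    Equ N (layer i (f.comp g) b) ((layer i f b).comp (layer i g b)) := by
  have hid : ∀ n, Equ N (Diagram.id n) ((Diagram.id n).comp (Diagram.id n)) := fun n =>
    (Equ.of_rel (Rel.id_comp _)).symm
  refine (Equ.tensor (((hid i).tensor (Equ.refl _)).trans
    (Equ.of_rel (Rel.interchange _ _ _ _))) (hid b)).trans ?_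
  exact Equ.of_rel (Rel.interchange _ _ _ _)

theorem Equ.layer_tensor {p q p' q' : ℕ} (f : Diagram p q) (g : Diagram p' q') (i b : ℕ)
    (h : i + q + (p' + b) = i + q + p' + b) :
    Equ N (layer i (f.tensor g) b)
      (((layer i f (p' + b)).cast rfl h).comp (layer (i + q) g b)) := by
  have h1 : Equ N ((layer i f (p' + b)).cast rfl h)
      ((((Diagram.id i).tensor f).tensor (Diagram.id p')).tensor (Diagram.id b)) := by
    refine (Equ.cast _ _ _).trans (Equ.trans ?_ (Equ.assoc _ _ _).symm)
    exact Equ.tensor (Equ.refl _) (Equ.of_rel (Rel.id_tensor_id _ _)).symm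
  refine Equ.trans ?_ (Equ.comp h1.symm (Equ.refl _))
  refine Equ.trans ?_ (Equ.of_rel (Rel.interchange _ _ _ _))
  refine Equ.tensor ?_ (Equ.of_rel (Rel.id_comp _)).symm
  refine Equ.trans ?_ (Equ.of_rel (Rel.interchange _ _ _ _))
  refine (Equ.assoc _ _ _).symm.trans (Equ.tensor ?_ (Equ.of_rel (Rel.id_comp _)).symm)
  exact (Equ.of_rel (Rel.comp_id _)).symm

theorem Equ.layer_tensor' {p q p' q' : ℕ} (f : Diagram p q) (g : Diagram p' q') (i b : ℕ)
    (h : i + p + q' + b = i + p + (q' + b)) :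
    Equ N (layer i (f.tensor g) b)
      (((layer (i + p) g b).cast rfl h).comp (layer i f (q' + b))) := by
  have h1 : Equ N (layer i f (q' + b))
      ((((Diagram.id i).tensor f).tensor (Diagram.id q')).tensor (Diagram.id b)) := by
    refine Equ.trans ?_ (Equ.assoc _ _ _).symm
    exact Equ.tensor (Equ.refl _) (Equ.of_rel (Rel.id_tensor_id _ _)).symm
  refine Equ.trans ?_ (Equ.comp (Equ.cast _ _ _).symm h1.symm)
  refine Equ.trans ?_ (Equ.of_rel (Rel.interchange _ _ _ _))
  refine Equ.tensor ?_ (Equ.of_rel (Rel.id_comp _)).symm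
  refine Equ.trans ?_ (Equ.of_rel (Rel.interchange _ _ _ _))
  refine (Equ.assoc _ _ _).symm.trans (Equ.tensor ?_ (Equ.of_rel (Rel.comp_id _)).symm)
  refine Equ.trans ?_ (Equ.of_rel (Rel.id_comp _)).symm
  exact Equ.refl _

theorem act_comp {k p q r : ℕ} (f : Diagram p q) (g : Diagram q r) (i : ℕ) :
    act N k (f.comp g) i = act N k g i * act N k f i := by
  ext1 x; funext m
  rw [Module.End.mul_apply]
  rcases lt_or_ge m (i + r) with h | h
  · rw [act_apply_of_lt _ h, act_apply_of_lt _ h]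
  · obtain ⟨b, rfl⟩ := Nat.exists_eq_add_of_le h
    rw [act_apply (f.comp g) i b rfl rfl, act_apply g i b rfl rfl, act_apply f i b rfl rfl,
      ← post_comp_apply]
    exact congrArg (· (x (i + p + b))) (post_congr (Equ.layer_comp f g i b))

/-- The left factor of a tensor product may be applied first; the right factor is then shifted by
its outputs. -/
theorem act_tensor {k p q p' q' : ℕ} (f : Diagram p q) (g : Diagram p' q') (i : ℕ) :
    act N k (f.tensor g) i = act N k g (i + q) * act N k f i := by
  ext1 x; funext m
  rw [Module.End.mul_apply]
  rcases lt_or_ge m (i + (q + q')) with h | h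
  · rw [act_apply_of_lt _ h, act_apply_of_lt _ (by omega)]
  · obtain ⟨b, rfl⟩ := Nat.exists_eq_add_of_le h
    have h1 : i + q + q' + b = i + (q + q') + b := by omega
    rw [act_apply (f.tensor g) i b rfl rfl, act_apply g (i + q) b rfl h1,
      act_apply f i (p' + b) (m := i + (p + p') + b) (by omega) (by omega), ← post_comp_apply]
    rw [post_congr]
    refine (Equ.cast _ _ _).trans ((Equ.layer_tensor f g i b (by omega)).trans ?_)
    exact Equ.comp ((Equ.cast _ _ _).trans (Equ.cast _ _ _).symm) (Equ.cast _ _ _).symm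

/-- The right factor of a tensor product may be applied first; it is then shifted by the inputs of
the left factor. -/
theorem act_tensor' {k p q p' q' : ℕ} (f : Diagram p q) (g : Diagram p' q') (i : ℕ) :
    act N k (f.tensor g) i = act N k f i * act N k g (i + p) := by
  ext1 x; funext m
  rw [Module.End.mul_apply]
  rcases lt_or_ge m (i + (q + q')) with h | h
  · rw [act_apply_of_lt _ h]
    rcases lt_or_ge m (i + q) with h' | h'
    · rw [act_apply_of_lt _ h']
    · obtain ⟨b, rfl⟩ := Nat.exists_eq_add_of_le h'
      rw [act_apply f i b rfl rfl, act_apply_of_lt _ (by omega), map_zero]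
  · obtain ⟨b, rfl⟩ := Nat.exists_eq_add_of_le h
    have h1 : i + q + (q' + b) = i + (q + q') + b := by omega
    rw [act_apply (f.tensor g) i b rfl rfl, act_apply f i (q' + b) rfl h1,
      act_apply g (i + p) b (m := i + (p + p') + b) (by omega) (by omega), ← post_comp_apply]
    rw [post_congr]
    refine (Equ.cast _ _ _).trans ((Equ.layer_tensor' f g i b (by omega)).trans ?_)
    exact Equ.comp ((Equ.cast _ _ _).trans (Equ.cast _ _ _).symm) (Equ.cast _ _ _).symm

theorem act_cast {k p q p' q' : ℕ} (hp : p = p') (hq : q = q') (f : Diagram p q) (i : ℕ) :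
    act N k (f.cast hp hq) i = act N k f i := by
  subst hp hq; rfl

/-- The relations between diagrams hold for the operators. -/
theorem act_rel {k p q : ℕ} {a : ℂ} {f g : Diagram p q} (h : Rel N a f g) (i : ℕ) :
    act N k f i = a • act N k g i := by
  ext1 x; funext m
  rw [LinearMap.smul_apply, Pi.smul_apply]
  rcases lt_or_ge m (i + q) with h' | h'
  · rw [act_apply_of_lt _ h', act_apply_of_lt _ h', smul_zero]
  · obtain ⟨b, rfl⟩ := Nat.exists_eq_add_of_le h'
    rw [act_apply f i b rfl rfl, act_apply g i b rfl rfl]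
    have := NCBipart.of_rel ((h.tensor_right (Diagram.id i)).tensor_left (Diagram.id b))
    have := post_smul_congr (k := k) this
    change post N k (((Diagram.id i).tensor f).tensor (Diagram.id b)) _ = _
    rw [this]; rfl

theorem Equ.layer_id (i n b : ℕ) : Equ N (layer i (Diagram.id n) b) (Diagram.id (i + n + b)) :=
  (Equ.tensor (Equ.of_rel (Rel.id_tensor_id _ _)) (Equ.refl _)).trans
    (Equ.of_rel (Rel.id_tensor_id _ _))

theorem post_id {k l : ℕ} (x : NCBipart N k l) : post N k (Diagram.id l) x = x := by
  have : post N k (Diagram.id l) = LinearMap.id := by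
    apply NCBipart.hom_ext
    intro f
    rw [post_of, LinearMap.id_apply]
    exact NCBipart.of_eq_of_rel (Rel.comp_id f)
  rw [this]; rfl

theorem act_id_apply {k n i m : ℕ} (x : Family N k) (h : i + n ≤ m) :
    act N k (Diagram.id n) i x m = x m := by
  obtain ⟨b, rfl⟩ := Nat.exists_eq_add_of_le h
  rw [act_apply (Diagram.id n) i b rfl rfl]
  change post N k (layer i (Diagram.id n) b) _ = _
  rw [post_congr (Equ.layer_id i n b), post_id]

theorem act_congr_apply {k p q i m : ℕ} (g : Diagram p q) {x y : Family N k}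
    (h : ∀ b, i + q + b = m → x (i + p + b) = y (i + p + b)) :
    act N k g i x m = act N k g i y m := by
  rcases lt_or_ge m (i + q) with h' | h'
  · rw [act_apply_of_lt _ h', act_apply_of_lt _ h']
  · obtain ⟨b, rfl⟩ := Nat.exists_eq_add_of_le h'
    rw [act_apply g i b rfl rfl, act_apply g i b rfl rfl, h b rfl]

theorem act_mul_act_id {k p q n i j : ℕ} (g : Diagram p q) (h : i + n ≤ j + p) :
    act N k g j * act N k (Diagram.id n) i = act N k g j := by
  ext1 x; funext m
  rw [Module.End.mul_apply]
  apply act_congr_apply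
  intro b hb
  rw [act_id_apply _ (by omega)]

theorem act_id_mul_act_id {k m n i : ℕ} :
    act N k (Diagram.id m) i * act N k (Diagram.id n) (i + m) = act N k (Diagram.id (m + n)) i := by
  rw [← act_tensor', act_rel (Rel.id_tensor_id m n), one_smul]

theorem act_id_mul_act_id' {k m n i : ℕ} :
    act N k (Diagram.id n) (i + m) * act N k (Diagram.id m) i = act N k (Diagram.id (m + n)) i := by
  rw [← act_tensor, act_rel (Rel.id_tensor_id m n), one_smul]

theorem act_id_mul_act {k p q n i j : ℕ} (g : Diagram p q) (h : i + n ≤ j + q) :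
    act N k (Diagram.id n) i * act N k g j = act N k g j := by
  ext1 x; funext m
  rw [Module.End.mul_apply]
  rcases lt_or_ge m (i + n) with h' | h'
  · rw [act_apply_of_lt _ h', act_apply_of_lt _ (by omega)]
  · rw [act_id_apply _ h']

/-- Diagrams applied to disjoint ranges of strings commute, up to the shift of positions. -/
theorem act_commute {k p q p' q' i j : ℕ} (f : Diagram p q) (g : Diagram p' q') (h : i ≤ j) :
    act N k g (j + q) * act N k f i = act N k f i * act N k g (j + p) := by
  obtain ⟨d, rfl⟩ := Nat.exists_eq_add_of_le h
  have h1 := act_tensor (N := N) (k := k) (f.tensor (Diagram.id d)) g i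
  have h2 := act_tensor' (N := N) (k := k) (f.tensor (Diagram.id d)) g i
  rw [act_tensor f (Diagram.id d), ← mul_assoc, act_mul_act_id _ (by omega)] at h1
  rw [act_tensor' f (Diagram.id d), mul_assoc] at h2
  rw [show i + (q + d) = i + d + q by omega] at h1
  rw [show i + (p + d) = i + d + p by omega] at h2
  rw [← h1, h2, act_id_mul_act _ (by omega)]

/-- The identity of `k`, as a family. -/
noncomputable def unitFamily (N : ℂ) (k : ℕ) : Family N k :=
  Pi.single k (NCBipart.of N (Diagram.id k))

/-- A diagram is recovered from its operator, so that equations between morphisms can be proved for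
operators. -/
theorem act_unitFamily {k l : ℕ} (f : Diagram k l) :
    act N k f 0 (unitFamily N k) = Pi.single l (NCBipart.of N f) := by
  funext m
  have e0 : ∀ n : ℕ, n ≠ k → unitFamily N k n = 0 := fun n hn => Pi.single_eq_of_ne hn _
  rcases lt_or_ge m (0 + l) with h' | h'
  · rw [act_apply_of_lt _ h', Pi.single_eq_of_ne (by omega)]
  · obtain ⟨b, rfl⟩ := Nat.exists_eq_add_of_le h'
    rcases Nat.eq_zero_or_pos b with rfl | hb
    · have hl : 0 + l + 0 = l := by omega
      rw [act_apply f 0 0 (m := k) (by omega) rfl, unitFamily, Pi.single_eq_same, post_of]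
      have key : ∀ n (hn : n = l) (d : Diagram k n), Equ N d f →
          NCBipart.of N d = (Pi.single l (NCBipart.of N f) : Family N k) n := by
        intro n hn d hd
        subst hn
        rw [Pi.single_eq_same, hd.of_eq]
      refine key _ hl _ ?_
      refine (Equ.of_rel (Rel.id_comp _)).trans ((Equ.cast _ _ _).trans ?_)
      exact (Equ.of_rel_cast _ _ (Rel.tensor_unit _)).trans
        (Equ.of_rel_cast _ _ (Rel.unit_tensor f))
    · rw [act_apply f 0 b rfl rfl, e0 _ (by omega), map_zero, Pi.single_eq_of_ne (by omega)]

theorem Family.single_smul {k m : ℕ} (a : ℂ) (y : NCBipart N k m) :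
    (Pi.single m (a • y) : Family N k) = a • Pi.single m y :=
  (LinearMap.single ℂ (fun m => NCBipart N k m) m).map_smul a y

theorem Family.single_injective (N : ℂ) (k m : ℕ) :
    Function.Injective (fun y => Pi.single m y : NCBipart N k m → Family N k) :=
  Pi.single_injective (M := fun m => NCBipart N k m) m

theorem act_single {k p q i m m' : ℕ} (g : Diagram p q) (h : m + q = m' + p)
    (y : NCBipart N k m) :
    act N k g i (Pi.single m y) = Pi.single m' (act N k g i (Pi.single m y) m') := by
  funext n
  by_cases hn : n = m'
  · subst hn; rw [Pi.single_eq_same]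
  · rw [Pi.single_eq_of_ne hn]
    rcases lt_or_ge n (i + q) with h' | h'
    · rw [act_apply_of_lt _ h']
    · obtain ⟨c, rfl⟩ := Nat.exists_eq_add_of_le h'
      rw [act_apply g i c rfl rfl, Pi.single_eq_of_ne (by omega), map_zero]

theorem act_apply_eq_single {k p q i m m' : ℕ} (g : Diagram p q) (h : m + q = m' + p)
    (x : Family N k) : act N k g i x m' = act N k g i (Pi.single m (x m)) m' := by
  apply act_congr_apply
  intro b hb
  obtain rfl : i + p + b = m := by omega
  rw [Pi.single_eq_same]

theorem act_id_single {k n i m : ℕ} (h : i + n ≤ m) (y : NCBipart N k m) :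
    act N k (Diagram.id n) i (Pi.single m y) = Pi.single m y := by
  rw [act_single (Diagram.id n) rfl, act_id_apply _ h, Pi.single_eq_same]

/-- The effect of `act` on a single member of a family. -/
noncomputable def place (N : ℂ) (k : ℕ) {p q : ℕ} (g : Diagram p q) (i m m' : ℕ) :
    NCBipart N k m →ₗ[ℂ] NCBipart N k m' :=
  LinearMap.proj m' ∘ₗ act N k g i ∘ₗ LinearMap.single ℂ (fun m => NCBipart N k m) m

theorem single_place {k p q i m m' : ℕ} (g : Diagram p q) (h : m + q = m' + p)
    (y : NCBipart N k m) :
    (Pi.single m' (place N k g i m m' y) : Family N k) = act N k g i (Pi.single m y) :=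
  (act_single g h y).symm

theorem act_apply_eq_place {k p q i m m' : ℕ} (g : Diagram p q) (h : m + q = m' + p)
    (x : Family N k) : act N k g i x m' = place N k g i m m' (x m) :=
  act_apply_eq_single g h x

end

/-! ### Relations between caps, cups and connecters -/

section

variable {N : ℂ} {k : ℕ}

/-- The other colour. -/
def Colour.swap : Colour → Colour
  | .black => .white
  | .white => .black

@[simp] theorem Colour.swap_swap (c : Colour) : c.swap.swap = c := by cases c <;> rfl

/-- The spider of colour `c` with `p` inputs and `q` outputs, attached to the outputs from `i`
on. -/
noncomputable abbrev legs (N : ℂ) (k : ℕ) (c : Colour) (p q i : ℕ) : Module.End ℂ (Family N k) :=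
  act N k (spider c p q) i

theorem Diagram.flip_cast {p q p' q' : ℕ} (hp : p = p') (hq : q = q') (f : Diagram p q) :
    (f.cast hp hq).flip = f.flip.cast hq hp := by
  subst hp hq; rfl

theorem Diagram.flip_flip {p q : ℕ} (f : Diagram p q) : f.flip.flip = f := by
  induction f with
  | id | spider => rfl
  | comp f g hf hg => simp only [Diagram.flip, hf, hg]
  | tensor f g hf hg => simp only [Diagram.flip, hf, hg]

/-- Fusion of two spiders along `m` strings, the spider on the right being applied first. -/
theorem legs_fuse (c : Colour) (k₁ l₁ k₂ l₂ m i : ℕ) (hm : 1 ≤ m) :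
    legs N k c (k₁ + m) l₁ i * legs N k c k₂ (m + l₂) (i + k₁) =
      legs N k c (k₁ + k₂) (l₁ + l₂) i := by
  have h := act_rel (k := k) (Rel.fuse (N := N) c k₁ l₁ k₂ l₂ m hm) i
  rw [one_smul, act_comp, act_cast, act_tensor', act_tensor,
    act_mul_act_id (spider c k₂ (m + l₂)) (by omega), mul_assoc, act_id_mul_act _ (by omega)] at h
  exact h

/-- Fusion of two spiders along `m` strings, the spider on the left being applied first. This is the
reflected fusion relation. -/
theorem legs_fuse' (c : Colour) (k₁ l₁ k₂ l₂ m i : ℕ) (hm : 1 ≤ m) :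
    legs N k c (m + l₂) k₂ (i + k₁) * legs N k c l₁ (k₁ + m) i =
      legs N k c (l₁ + l₂) (k₁ + k₂) i := by
  have h := act_rel (k := k) (Rel.fuse (N := N) c k₁ l₁ k₂ l₂ m hm).flip i
  simp only [Diagram.flip, Diagram.flip_cast] at h
  rw [one_smul, act_comp, act_cast, act_tensor, act_tensor, act_mul_act_id _ (by omega),
    ← mul_assoc, act_mul_act_id _ (by omega)] at h
  exact h

theorem legs_string (c : Colour) (i : ℕ) : legs N k c 1 1 i = act N k (Diagram.id 1) i := by
  rw [legs, act_rel (Rel.string c), one_smul]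

theorem legs_isolated (c : Colour) (i : ℕ) : legs N k c 0 0 i = N • act N k (Diagram.id 0) i := by
  rw [legs, act_rel (Rel.isolated c)]

/-- The cap `2 → 0` attached to the outputs `i` and `i + 1`. -/
noncomputable abbrev capAct (N : ℂ) (k i : ℕ) : Module.End ℂ (Family N k) := act N k Diagram.pair i

/-- The cup `0 → 2` inserted before the output `i`. -/
noncomputable abbrev cupAct (N : ℂ) (k i : ℕ) : Module.End ℂ (Family N k) :=
  act N k Diagram.pair.flip i

theorem legs_cap (c : Colour) (i : ℕ) : legs N k c 2 0 i = capAct N k i := by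
  cases c
  · rfl
  · rw [capAct, Diagram.pair, act_rel (Rel.pair), one_smul]

theorem legs_cup (c : Colour) (i : ℕ) : legs N k c 0 2 i = cupAct N k i := by
  cases c
  · rfl
  · have := act_rel (N := N) (k := k) (Rel.pair).flip i
    rw [one_smul] at this
    exact this.symm

/-- The reflection of the double edge relation is the same relation with the colours exchanged. -/
theorem legs_double_edge (c : Colour) (i : ℕ) :
    legs N k c 2 1 i * legs N k c.swap 1 2 i =
      N⁻¹ • (legs N k c 0 1 i * legs N k c.swap 1 0 i) := by
  cases c
  · have := act_rel (N := N) (k := k) Rel.double_edge i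
    rwa [act_comp, act_comp] at this
  · have := act_rel (N := N) (k := k) (Rel.double_edge).flip i
    simp only [Diagram.flip] at this
    rwa [act_comp, act_comp] at this

theorem legs_two_two_sq (c : Colour) (i : ℕ) :
    legs N k c 2 2 i * legs N k c 2 2 i = legs N k c 2 2 i :=
  legs_fuse c 0 2 2 0 2 i (by norm_num)

theorem legs_two_two_eq (c : Colour) (i : ℕ) :
    legs N k c 2 2 i = legs N k c 1 2 i * legs N k c 2 1 i :=
  (legs_fuse c 0 2 2 0 1 i le_rfl).symm

/-- Overlapping connecters of the same colour commute: both products are the spider with three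
inputs and three outputs. -/
theorem legs_two_two_comm (c : Colour) (i : ℕ) :
    legs N k c 2 2 i * legs N k c 2 2 (i + 1) = legs N k c 2 2 (i + 1) * legs N k c 2 2 i :=
  (legs_fuse c 1 2 2 1 1 i le_rfl).trans (legs_fuse' c 1 2 2 1 1 i le_rfl).symm

/-- Connecters of opposite colours at the same position are joined by a double edge, which breaks.
-/
theorem legs_two_two_mul_swap (c : Colour) (i : ℕ) :
    legs N k c 2 2 i * legs N k c.swap 2 2 i = N⁻¹ • (cupAct N k i * capAct N k i) := by
  have h1 : legs N k c.swap 1 0 i * legs N k c.swap 2 1 i = legs N k c.swap 2 0 i :=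
    legs_fuse c.swap 0 0 2 0 1 i le_rfl
  have h2 : legs N k c 1 2 i * legs N k c 0 1 i = legs N k c 0 2 i :=
    legs_fuse c 0 2 0 0 1 i le_rfl
  rw [legs_two_two_eq, legs_two_two_eq, mul_assoc, ← mul_assoc (legs N k c 2 1 i),
    legs_double_edge, smul_mul_assoc, mul_smul_comm, mul_assoc (legs N k c 0 1 i), h1,
    ← mul_assoc, h2, legs_cap, legs_cup]

/-- A bigon between a black and a white spider opens. -/
theorem bigon_left (c : Colour) (i : ℕ) :
    legs N k c 2 1 i * legs N k c.swap 2 2 (i + 1) * legs N k c 1 2 i =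
      N⁻¹ • act N k (Diagram.id 2) i := by
  have h1 : legs N k c.swap 2 2 (i + 1) = capAct N k (i + 1) * legs N k c.swap 1 3 (i + 2) := by
    rw [← legs_cap c.swap]; exact (legs_fuse c.swap 1 0 1 2 1 (i + 1) le_rfl).symm
  have h2 : legs N k c.swap 1 3 (i + 2) * legs N k c 1 2 i =
      legs N k c 1 2 i * legs N k c.swap 1 3 (i + 1) := act_commute _ _ (Nat.le_refl i)
  have h3 : capAct N k (i + 1) * legs N k c 1 2 i = legs N k c 2 1 i := by
    rw [← legs_cap c]; exact legs_fuse' c 1 1 0 1 1 i le_rfl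
  have h4 : legs N k c 2 1 i * legs N k c 2 1 i = legs N k c 2 1 i * legs N k c 2 1 (i + 1) :=
    (legs_fuse' c 0 2 1 1 1 i le_rfl).trans (legs_fuse c 1 1 2 0 1 i le_rfl).symm
  have h5 : legs N k c.swap 1 3 (i + 1) =
      legs N k c.swap 1 2 (i + 1) * legs N k c.swap 1 2 (i + 1) :=
    (legs_fuse c.swap 0 2 1 1 1 (i + 1) le_rfl).symm
  have h6 : legs N k c.swap 1 0 (i + 1) * legs N k c.swap 1 2 (i + 1) =
      legs N k c.swap 1 1 (i + 1) :=
    legs_fuse c.swap 0 0 1 1 1 (i + 1) le_rfl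
  have h7 : legs N k c 2 1 i * legs N k c 0 1 (i + 1) = legs N k c 1 1 i :=
    legs_fuse c 1 1 0 0 1 i le_rfl
  calc _ = legs N k c 2 1 i * (capAct N k (i + 1) * legs N k c 1 2 i) *
        legs N k c.swap 1 3 (i + 1) := by rw [h1, mul_assoc, mul_assoc, h2]; simp only [mul_assoc]
    _ = legs N k c 2 1 i * (legs N k c 2 1 (i + 1) * legs N k c.swap 1 2 (i + 1)) *
        legs N k c.swap 1 2 (i + 1) := by rw [h3, h4, h5]; simp only [mul_assoc]
    _ = N⁻¹ • ((legs N k c 2 1 i * legs N k c 0 1 (i + 1)) * (legs N k c.swap 1 0 (i + 1) *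
        legs N k c.swap 1 2 (i + 1))) := by
          rw [legs_double_edge, mul_smul_comm, smul_mul_assoc]; simp only [mul_assoc]
    _ = N⁻¹ • act N k (Diagram.id 2) i := by
          rw [h6, h7, legs_string, legs_string, act_id_mul_act_id]

/-- The mirror image of `bigon_left`. -/
theorem bigon_right (c : Colour) (i : ℕ) :
    legs N k c 2 1 (i + 1) * legs N k c.swap 2 2 i * legs N k c 1 2 (i + 1) =
      N⁻¹ • act N k (Diagram.id 2) i := by
  have h1 : legs N k c.swap 2 2 i = capAct N k (i + 2) * legs N k c.swap 1 3 i := by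
    rw [← legs_cap c.swap]; exact (legs_fuse' c.swap 2 1 0 1 1 i le_rfl).symm
  have h2 : legs N k c.swap 1 3 i * legs N k c 1 2 (i + 1) =
      legs N k c 1 2 (i + 3) * legs N k c.swap 1 3 i :=
    (act_commute (spider c.swap 1 3) (spider c 1 2) (Nat.le_refl i)).symm
  have h3 : capAct N k (i + 2) * legs N k c 1 2 (i + 3) = legs N k c 2 1 (i + 2) := by
    rw [← legs_cap c]; exact legs_fuse c 1 0 1 1 1 (i + 2) le_rfl
  have h4 : legs N k c 2 1 (i + 1) * legs N k c 2 1 (i + 2) =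
      legs N k c 2 1 (i + 1) * legs N k c 2 1 (i + 1) :=
    (legs_fuse c 1 1 2 0 1 (i + 1) le_rfl).trans (legs_fuse' c 0 2 1 1 1 (i + 1) le_rfl).symm
  have h5 : legs N k c.swap 1 3 i = legs N k c.swap 1 2 (i + 1) * legs N k c.swap 1 2 i :=
    (legs_fuse' c.swap 1 1 2 0 1 i le_rfl).symm
  have h6 : legs N k c.swap 1 0 (i + 1) * legs N k c.swap 1 2 i = legs N k c.swap 1 1 i :=
    legs_fuse' c.swap 1 1 0 0 1 i le_rfl
  have h7 : legs N k c 2 1 (i + 1) * legs N k c 0 1 (i + 1) = legs N k c 1 1 (i + 1) :=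
    legs_fuse' c 0 0 1 1 1 (i + 1) le_rfl
  calc _ = legs N k c 2 1 (i + 1) * (capAct N k (i + 2) * legs N k c 1 2 (i + 3)) *
        legs N k c.swap 1 3 i := by rw [h1, mul_assoc, mul_assoc, h2]; simp only [mul_assoc]
    _ = legs N k c 2 1 (i + 1) * (legs N k c 2 1 (i + 1) * legs N k c.swap 1 2 (i + 1)) *
        legs N k c.swap 1 2 i := by rw [h3, h4, h5]; simp only [mul_assoc]
    _ = N⁻¹ • ((legs N k c 2 1 (i + 1) * legs N k c 0 1 (i + 1)) * (legs N k c.swap 1 0 (i + 1) *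
        legs N k c.swap 1 2 i)) := by
          rw [legs_double_edge, mul_smul_comm, smul_mul_assoc]; simp only [mul_assoc]
    _ = N⁻¹ • act N k (Diagram.id 2) i := by
          rw [h6, h7, legs_string, legs_string, act_id_mul_act_id']

/-- The Temperley-Lieb relation between neighbouring connecters of opposite colours. The identity
of three strings on the right hand side accounts for the vanishing of the left hand side where
there are fewer strings. -/
theorem legs_braid_left (c : Colour) (i : ℕ) :
    legs N k c 2 2 i * legs N k c.swap 2 2 (i + 1) * legs N k c 2 2 i =
      N⁻¹ • (legs N k c 2 2 i * act N k (Diagram.id 3) i) := by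
  have h : act N k (Diagram.id 2) i * legs N k c 2 1 i =
      legs N k c 2 1 i * act N k (Diagram.id 3) i := by
    have h1 : act N k (Diagram.id 1) (i + 1) * legs N k c 2 1 i =
      legs N k c 2 1 i * act N k (Diagram.id 1) (i + 2) := act_commute _ _ (Nat.le_refl i)
    rw [← act_id_mul_act_id (m := 1) (n := 1), mul_assoc, h1, ← mul_assoc,
      act_id_mul_act _ (by omega), ← act_id_mul_act_id (m := 2) (n := 1), ← mul_assoc,
      act_mul_act_id (spider c 2 1) (le_refl (i + 2))]
  calc _ = legs N k c 1 2 i * (legs N k c 2 1 i * legs N k c.swap 2 2 (i + 1) * legs N k c 1 2 i) *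
        legs N k c 2 1 i := by rw [legs_two_two_eq c]; simp only [mul_assoc]
    _ = _ := by rw [bigon_left, mul_smul_comm, smul_mul_assoc, mul_assoc, h, ← mul_assoc,
      ← legs_two_two_eq]

theorem legs_braid_right (c : Colour) (i : ℕ) :
    legs N k c 2 2 (i + 1) * legs N k c.swap 2 2 i * legs N k c 2 2 (i + 1) =
      N⁻¹ • legs N k c 2 2 (i + 1) := by
  calc _ = legs N k c 1 2 (i + 1) *
        (legs N k c 2 1 (i + 1) * legs N k c.swap 2 2 i * legs N k c 1 2 (i + 1)) *
        legs N k c 2 1 (i + 1) := by rw [legs_two_two_eq c]; simp only [mul_assoc]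
    _ = _ := by rw [bigon_right, mul_smul_comm, smul_mul_assoc, mul_assoc,
      act_id_mul_act _ (by omega), ← legs_two_two_eq]

theorem capAct_mul_cupAct_succ (i : ℕ) :
    capAct N k i * cupAct N k (i + 1) = act N k (Diagram.id 1) i := by
  rw [← legs_cap .black, ← legs_cup .black, ← legs_string .black]
  exact legs_fuse _ 1 0 0 1 1 i le_rfl

theorem capAct_succ_mul_cupAct (i : ℕ) :
    capAct N k (i + 1) * cupAct N k i = act N k (Diagram.id 1) i := by
  rw [← legs_cap .black, ← legs_cup .black, ← legs_string .black]
  exact legs_fuse' _ 1 0 0 1 1 i le_rfl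

theorem capAct_mul_cupAct (i : ℕ) :
    capAct N k i * cupAct N k i = N • act N k (Diagram.id 0) i := by
  rw [← legs_cap .black, ← legs_cup .black, ← legs_isolated .black]
  exact legs_fuse _ 0 0 0 0 2 i (by norm_num)

theorem legs_mul_cupAct (c : Colour) (i : ℕ) :
    legs N k c 2 2 i * cupAct N k i = cupAct N k i := by
  rw [← legs_cup c]
  exact legs_fuse c 0 2 0 0 2 i (by norm_num)

theorem capAct_mul_legs (c : Colour) (i : ℕ) :
    capAct N k i * legs N k c 2 2 i = capAct N k i := by
  rw [← legs_cap c]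
  exact legs_fuse c 0 0 2 0 2 i (by norm_num)

end

/-! ### Normal forms in representations of Temperley-Lieb algebras -/

section TemperleyLieb

variable {𝕜 M : Type*} [Field 𝕜] [AddCommGroup M] [Module 𝕜 M]

/-- The relations of the Temperley-Lieb algebra on `L` strands with loop parameter `d`, for the
operators `e i` with `i + 2 ≤ L`. -/
structure IsTemperleyLieb (e : ℕ → Module.End 𝕜 M) (d : 𝕜) (L : ℕ) : Prop where
  sq : ∀ i, e i * e i = d • e i
  left : ∀ i, i + 3 ≤ L → e i * e (i + 1) * e i = e i
  right : ∀ i, i + 3 ≤ L → e (i + 1) * e i * e (i + 1) = e (i + 1)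
  comm : ∀ i j, i + 2 ≤ j → Commute (e i) (e j)

/-- The product `e i * e (i + 1) * ⋯ * e (m - 1)`. Applied to a diagram with an innermost arc at
`m, m + 1` it moves this arc to `i, i + 1`. -/
def chain (e : ℕ → Module.End 𝕜 M) (i m : ℕ) : Module.End 𝕜 M :=
  ((List.range' i (m - i)).map e).prod

variable {e : ℕ → Module.End 𝕜 M} {d : 𝕜} {L : ℕ}

@[simp]
theorem chain_self (i : ℕ) : chain e i i = 1 := by simp [chain]

theorem chain_eq_mul {i m : ℕ} (h : i < m) : chain e i m = e i * chain e (i + 1) m := by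
  obtain ⟨n, rfl⟩ := Nat.exists_eq_add_of_lt h
  rw [chain, chain, show i + n + 1 - i = n + 1 by omega, show i + n + 1 - (i + 1) = n by omega,
    List.range'_succ, List.map_cons, List.prod_cons]

theorem chain_mul_chain {i j m : ℕ} (h : i ≤ j) (h' : j ≤ m) :
    chain e i j * chain e j m = chain e i m := by
  obtain ⟨a, rfl⟩ := Nat.exists_eq_add_of_le h
  obtain ⟨b, rfl⟩ := Nat.exists_eq_add_of_le h'
  rw [chain, chain, chain, ← List.prod_append, ← List.map_append]
  rw [show i + a - i = a by omega, show i + a + b - (i + a) = b by omega,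
    show i + a + b - i = a + b by omega, ← List.range'_append_1]

theorem chain_succ {i m : ℕ} (h : i ≤ m) : chain e i (m + 1) = chain e i m * e m := by
  rw [← chain_mul_chain h (Nat.le_succ m), chain_eq_mul (Nat.lt_succ_self m), chain_self, mul_one]

theorem map_chain {M' : Type*} [AddCommGroup M'] [Module 𝕜 M'] {e' : ℕ → Module.End 𝕜 M'}
    (f : M →ₗ[𝕜] M') {i m : ℕ} (h : ∀ t, t < m → ∀ x, f (e t x) = e' t (f x)) (x : M) :
    f (chain e i m x) = chain e' i m (f x) := by
  rcases le_or_gt m i with hm | hm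
  · simp [chain, Nat.sub_eq_zero_of_le hm]
  · obtain ⟨n, rfl⟩ := Nat.exists_eq_add_of_lt hm
    induction n generalizing i with
    | zero => simp [chain_eq_mul, h]
    | succ n ih =>
      rw [chain_eq_mul hm, chain_eq_mul hm, Module.End.mul_apply, h _ hm, Module.End.mul_apply]
      have := ih (i := i + 1) (fun t ht => h t (by omega)) (by omega)
      rw [show i + (n + 1) + 1 = i + 1 + n + 1 by omega, this]

theorem commute_chain {x : Module.End 𝕜 M} {i m : ℕ} (h : ∀ t, i ≤ t → t < m → Commute x (e t)) :
    Commute x (chain e i m) := by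
  apply Commute.list_prod_right
  intro y hy
  obtain ⟨t, ht, rfl⟩ := List.mem_map.1 hy
  rw [List.mem_range'_1] at ht
  exact h t (by omega) (by omega)

/-- Words for the diagrams of arcs: each letter inserts an innermost arc, by moving an arc at the
end into the given position. -/
def word (e : ℕ → Module.End 𝕜 M) : List ℕ → Module.End 𝕜 M
  | [] => 1
  | i :: s => chain e i (2 * s.length) * word e s

theorem commute_word {x : Module.End 𝕜 M} {s : List ℕ}
    (h : ∀ t, t + 2 ≤ 2 * s.length → Commute x (e t)) : Commute x (word e s) := by
  induction s with
  | nil => exact Commute.one_right x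
  | cons i s ih =>
    rw [List.length_cons] at h
    exact (commute_chain fun t _ ht => h t (by omega)).mul_right (ih fun t ht => h t (by omega))

theorem map_word {M' : Type*} [AddCommGroup M'] [Module 𝕜 M'] {e' : ℕ → Module.End 𝕜 M'}
    (f : M →ₗ[𝕜] M') {s : List ℕ} (h : ∀ t, t + 2 ≤ 2 * s.length → ∀ x, f (e t x) = e' t (f x))
    (x : M) : f (word e s x) = word e' s (f x) := by
  induction s with
  | nil => rfl
  | cons i s ih =>
    rw [List.length_cons] at h
    rw [word, word, Module.End.mul_apply, Module.End.mul_apply,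
      map_chain f fun t ht => h t (by omega), ih fun t ht => h t (by omega)]

/-- The upper bound for the next letter of a normal form. -/
def height : List ℕ → ℕ
  | [] => 0
  | i :: _ => i + 1

/-- Normal forms of noncrossing pairings: the first letter is the position of the leftmost innermost
arc, the remaining letters describe the pairing left when this arc is removed. -/
def IsNormal : List ℕ → Prop
  | [] => True
  | i :: s => i ≤ height s ∧ IsNormal s

theorem IsNormal.height_le {s : List ℕ} (h : IsNormal s) : height s ≤ s.length := by
  induction s with
  | nil => exact le_rfl
  | cons i s ih => exact Nat.succ_le_succ (h.1.trans (ih h.2))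

namespace IsTemperleyLieb

variable (H : IsTemperleyLieb e d L)
include H

theorem commute_of_ne {i j : ℕ} (h : i + 2 ≤ j ∨ j + 2 ≤ i) : Commute (e i) (e j) := by
  rcases h with h | h
  · exact H.comm i j h
  · exact (H.comm j i h).symm

theorem commute_chain_of {i k m : ℕ} (h : m + 1 ≤ k ∨ k + 2 ≤ i) :
    Commute (e k) (chain e i m) :=
  commute_chain fun _ _ _ => H.commute_of_ne (by omega)

theorem commute_chain_chain {i j k m : ℕ} (h : m + 1 ≤ k) :
    Commute (chain e k j) (chain e i m) :=
  (commute_chain fun _ _ _ => (H.commute_chain_of (by omega)).symm).symm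

/-- The eigenvalue equation says that `y` has an arc at `m, m + 1`; the two generators move it away
and back. -/
theorem absorb (hd : d ≠ 0) {m : ℕ} (hm : m + 3 ≤ L) {y : M} (hy : e m y = d • y) :
    e m (e (m + 1) y) = y := by
  have h := congrArg (fun f : Module.End 𝕜 M => f y) (H.left m hm)
  simp only [Module.End.mul_apply, hy, map_smul] at h
  exact smul_right_injective M hd h

/-- Insertion of two arcs in either order. -/
theorem chain_chain_apply (hd : d ≠ 0) {k j m : ℕ} (hkj : k ≤ j) (hjm : j ≤ m) (hm : m + 3 ≤ L)
    {y : M} (hy : e m y = d • y) :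
    chain e k (m + 2) (chain e j m y) = chain e (j + 2) (m + 2) (chain e k m y) := by
  rcases hjm.eq_or_lt with rfl | hlt
  · rw [chain_self, chain_self, Module.End.one_apply, Module.End.one_apply,
      ← chain_mul_chain hkj (by omega : j ≤ j + 2), chain_eq_mul (by omega : j < j + 2),
      chain_eq_mul (by omega : j + 1 < j + 2), chain_self, mul_one]
    simp only [Module.End.mul_apply]
    rw [H.absorb hd hm hy]
  · rw [← Module.End.mul_apply, ← Module.End.mul_apply]
    congr 1
    have c1 : Commute (e j) (chain e (j + 2) (m + 2)) := H.commute_chain_of (by omega)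
    have c2 : Commute (chain e (j + 2) (m + 2)) (chain e k (j + 1)) :=
      H.commute_chain_chain (by omega)
    calc chain e k (m + 2) * chain e j m
        = chain e k j * (e j * (e (j + 1) * (chain e (j + 2) (m + 2) * e j))) *
          chain e (j + 1) m := by
            rw [← chain_mul_chain hkj (by omega : j ≤ m + 2),
              chain_eq_mul (by omega : j < m + 2), chain_eq_mul (by omega : j + 1 < m + 2),
              chain_eq_mul hlt]
            simp only [mul_assoc]
      _ = chain e k j * (e j * e (j + 1) * e j) * chain e (j + 2) (m + 2) *
          chain e (j + 1) m := by rw [← c1.eq]; simp only [mul_assoc]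
      _ = chain e k (j + 1) * chain e (j + 2) (m + 2) * chain e (j + 1) m := by
            rw [H.left j (by omega), ← chain_succ hkj]
      _ = _ := by rw [← c2.eq, mul_assoc, chain_mul_chain (by omega) (by omega)]

variable {v : M} (hv : ∀ j, 2 * j + 2 ≤ L → e (2 * j) v = d • v)
include hv

/-- The arcs that have not yet been moved by a word are still present in its result. -/
theorem apply_word {s : List ℕ} (hs : 2 * s.length + 2 ≤ L) :
    e (2 * s.length) (word e s v) = d • word e s v := by
  have h : Commute (e (2 * s.length)) (word e s) :=
    commute_word fun t ht => H.commute_of_ne (by omega)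
  rw [← Module.End.mul_apply, h.eq, Module.End.mul_apply, hv _ hs, map_smul]

/-- Inserting an innermost arc into a normal form gives a normal form. -/
theorem exists_chain_word (hd : d ≠ 0) {s : List ℕ} (hs : IsNormal s)
    (hL : 2 * s.length + 2 ≤ L) {i : ℕ} (hi : i ≤ 2 * s.length) :
    ∃ s', IsNormal s' ∧ s'.length = s.length + 1 ∧ min (i + 1) (height s) ≤ height s' ∧
      chain e i (2 * s.length) (word e s v) = word e s' v := by
  induction s generalizing i with
  | nil =>
    obtain rfl : i = 0 := by simpa using hi
    exact ⟨[0], ⟨le_rfl, trivial⟩, rfl, Nat.zero_le _, rfl⟩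
  | cons j s ih =>
    rw [List.length_cons] at hi hL
    by_cases h : i ≤ j + 1
    · exact ⟨i :: j :: s, ⟨h, hs⟩, rfl, min_le_left _ _, rfl⟩
    · obtain ⟨i, rfl⟩ : ∃ i', i = i' + 2 := ⟨i - 2, by omega⟩
      obtain ⟨s', h1, h2, h3, h4⟩ := ih hs.2 (by omega) (i := i) (by omega)
      have hj := hs.1
      refine ⟨j :: s', ⟨?_, h1⟩, by simp [h2], min_le_right _ _, ?_⟩
      · refine le_trans ?_ h3
        exact le_min (by omega) hj
      · rw [List.length_cons, word, Module.End.mul_apply, word, Module.End.mul_apply, ← h4, h2,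
          Nat.mul_add, mul_one]
        exact (H.chain_chain_apply hd (by omega) (by omega) (by omega)
          (H.apply_word hv (by omega))).symm

/-- If a generator acts on a normal form by inserting an arc into a smaller one, the result is a
multiple of a normal form. -/
theorem exists_apply_word_of (hd : d ≠ 0) {s : List ℕ} {k : ℕ}
    (h : ∃ (a : 𝕜) (s' : List ℕ), IsNormal s' ∧ s'.length + 1 = s.length ∧
      e k (word e s v) = a • chain e k (2 * s'.length) (word e s' v))
    (hL : 2 * s.length ≤ L) (hk : k + 2 ≤ 2 * s.length) :
    ∃ (a : 𝕜) (s' : List ℕ), IsNormal s' ∧ s'.length = s.length ∧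
      e k (word e s v) = a • word e s' v := by
  obtain ⟨a, s', h1, h2, h3⟩ := h
  obtain ⟨s'', g1, g2, -, g4⟩ := H.exists_chain_word hv hd h1 (by omega) (i := k) (by omega)
  exact ⟨a, s'', g1, by omega, by rw [h3, g4]⟩

/-- A Temperley-Lieb generator applied to a normal form inserts its arc into some smaller normal
form. -/
theorem exists_apply_word_eq_chain (hd : d ≠ 0) {s : List ℕ} (hs : IsNormal s)
    (hL : 2 * s.length ≤ L) {k : ℕ} (hk : k + 2 ≤ 2 * s.length) :
    ∃ (a : 𝕜) (s' : List ℕ), IsNormal s' ∧ s'.length + 1 = s.length ∧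
      e k (word e s v) = a • chain e k (2 * s'.length) (word e s' v) := by
  obtain ⟨n, hn⟩ : ∃ n, s.length = n := ⟨_, rfl⟩
  induction n generalizing s k with
  | zero => omega
  | succ n ih =>
    obtain _ | ⟨i, s⟩ := s
    · simp at hn
    rw [List.length_cons] at hk hL hn
    obtain rfl : s.length = n := by omega
    rw [Nat.mul_add] at hk hL
    have hlen : ∀ s' : List ℕ, s'.length = s.length → s'.length + 1 = (i :: s).length :=
      fun s' h => by simp [h]
    -- a product of generators applied to a normal form is a normal form
    have hchain : ∀ n t : ℕ, t ≤ n → n + 1 ≤ 2 * s.length → ∃ (a : 𝕜) (s' : List ℕ),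
        IsNormal s' ∧ s'.length = s.length ∧ chain e t n (word e s v) = a • word e s' v := by
      intro n t htn hn
      obtain ⟨p, rfl⟩ := Nat.exists_eq_add_of_le htn
      induction p generalizing t with
      | zero => exact ⟨1, s, hs.2, rfl, by simp⟩
      | succ p ihp =>
        obtain ⟨a, s', h1, h2, h3⟩ := ihp (t + 1) (by omega) (by omega)
        obtain ⟨b, s'', g1, g2, g3⟩ := H.exists_apply_word_of hv hd
          (ih h1 (by omega) (k := t) (by omega) h2) (by omega) (by omega)
        refine ⟨a * b, s'', g1, g2.trans h2, ?_⟩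
        rw [chain_eq_mul (by omega), Module.End.mul_apply,
          show t + (p + 1) = t + 1 + p by omega, h3, map_smul, g3, smul_smul]
    have hm := H.apply_word hv (s := s) (by omega)
    have hi : i ≤ 2 * s.length := hs.1.trans (hs.2.height_le.trans (by omega))
    rw [word, Module.End.mul_apply]
    obtain ⟨m, hm'⟩ : ∃ m, m = 2 * s.length := ⟨_, rfl⟩
    rw [← hm'] at hm hi hk hL ⊢
    rcases lt_trichotomy k i with hki | rfl | hki
    · rcases (Nat.succ_le_of_lt hki).eq_or_lt with rfl | hki
      · exact ⟨1, s, hs.2, rfl, by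
          rw [one_smul, ← hm', chain_eq_mul (by omega : k < m)]; rfl⟩
      · obtain ⟨a, s', h1, h2, h3⟩ := ih hs.2 (by omega) (k := k) (by omega) rfl
        obtain ⟨i, rfl⟩ : ∃ i', i = i' + 2 := ⟨i - 2, by omega⟩
        obtain ⟨s'', g1, g2, -, g4⟩ := H.exists_chain_word hv hd h1 (by omega) (i := i) (by omega)
        refine ⟨a, s'', g1, hlen _ (by omega), ?_⟩
        have hc : Commute (e k) (chain e (i + 2) m) := H.commute_chain_of (by omega)
        rw [← Module.End.mul_apply, hc.eq, Module.End.mul_apply, h3, map_smul, ← g4]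
        have hms : m = 2 * s'.length + 2 := by omega
        rw [hms, g2, Nat.mul_add, ← H.chain_chain_apply hd (by omega) (by omega) (by omega)
          (H.apply_word hv (by omega))]
    · refine ⟨d, s, hs.2, rfl, ?_⟩
      rw [← hm']
      rcases hi.eq_or_lt with rfl | hlt
      · simpa using hm
      · rw [chain_eq_mul hlt, ← Module.End.mul_apply, ← mul_assoc, H.sq, smul_mul_assoc]; rfl
    · rcases (Nat.succ_le_of_lt hki).eq_or_lt with rfl | hki
      · refine ⟨1, s, hs.2, rfl, ?_⟩
        rw [← hm', one_smul, Nat.succ_eq_add_one]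
        rcases (show i + 1 ≤ m by omega).eq_or_lt with rfl | hlt
        · rw [chain_eq_mul (Nat.lt_succ_self i), chain_self, mul_one,
            Module.End.one_apply]
          -- the arc at `i + 1` of the argument is used to straighten the line
          have h := congrArg (fun f : Module.End 𝕜 M => f (word e s v)) (H.right i (by omega))
          simp only [Module.End.mul_apply, hm, map_smul] at h
          exact smul_right_injective M hd h
        · rw [chain_eq_mul (by omega : i < m), chain_eq_mul hlt, ← Module.End.mul_apply,
            ← mul_assoc, ← mul_assoc, H.right i (by omega)]
      · have key : e k (chain e i m (word e s v)) =
            chain e k m (chain e i (k - 1) (word e s v)) := by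
          obtain ⟨k, rfl⟩ : ∃ k', k = k' + 1 := ⟨k - 1, by omega⟩
          rw [Nat.add_sub_cancel, ← chain_mul_chain (by omega : i ≤ k) (by omega : k ≤ m),
            chain_eq_mul (by omega : k < m)]
          have c1 : Commute (e (k + 1)) (chain e i k) := H.commute_chain_of (by omega)
          rw [← Module.End.mul_apply, ← mul_assoc, c1.eq, mul_assoc, Module.End.mul_apply]
          rcases (show k + 1 ≤ m by omega).eq_or_lt with rfl | hlt
          · rw [chain_self, mul_one, Module.End.mul_apply, Module.End.one_apply]
            have h := congrArg (fun f : Module.End 𝕜 M => f (word e s v)) (H.right k (by omega))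
            simp only [Module.End.mul_apply, hm, map_smul] at h
            rw [smul_right_injective M hd h]
          · have c2 : Commute (chain e (k + 1) m) (chain e i k) := H.commute_chain_chain (by omega)
            rw [← Module.End.mul_apply (chain e (k + 1) m), c2.eq, Module.End.mul_apply,
              chain_eq_mul hlt, ← Module.End.mul_apply (e (k + 1)), ← mul_assoc, ← mul_assoc,
              H.right k (by omega), ← Module.End.mul_apply]
        obtain ⟨a, s', h1, h2, h3⟩ := hchain (k - 1) i (by omega) (by omega)
        refine ⟨a, s', h1, hlen _ h2, ?_⟩
        rw [key, h3, map_smul, h2, ← hm']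

/-- A Temperley-Lieb generator maps normal forms to multiples of normal forms. -/
theorem exists_apply_word (hd : d ≠ 0) {s : List ℕ} (hs : IsNormal s)
    (hL : 2 * s.length ≤ L) {k : ℕ} (hk : k + 2 ≤ 2 * s.length) :
    ∃ (a : 𝕜) (s' : List ℕ), IsNormal s' ∧ s'.length = s.length ∧
      e k (word e s v) = a • word e s' v :=
  H.exists_apply_word_of hv hd (H.exists_apply_word_eq_chain hv hd hs hL hk) hL hk

end IsTemperleyLieb

end TemperleyLieb

/-! ### Two commuting Temperley-Lieb algebras and the upper bound -/

section

/-- The colour of the operator at position `i` in the Temperley-Lieb algebra named by `c`. -/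
def altColour (c : Colour) (i : ℕ) : Colour := if Even i then c else c.swap

theorem altColour_succ (c : Colour) (i : ℕ) : altColour c (i + 1) = (altColour c i).swap := by
  by_cases h : Even i <;> simp [altColour, Nat.even_add_one, h]

theorem altColour_swap (c : Colour) (i : ℕ) : altColour c.swap i = (altColour c i).swap := by
  by_cases h : Even i <;> simp [altColour, h]

theorem altColour_altColour (c : Colour) (i : ℕ) : altColour (altColour c i) i = c := by
  by_cases h : Even i <;> simp [altColour, h]

variable {δ : ℂ}

/-- The generators of two commuting Temperley-Lieb algebras acting on the morphisms `0 → m`: for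
`c = black` these are the black connecters at even and the white connecters at odd positions, for
`c = white` it is the other way round. The factor `δ` makes both loop parameters equal to `δ`. -/
noncomputable def tl (δ : ℂ) (c : Colour) (m i : ℕ) : Module.End ℂ (NCBipart (δ ^ 2) 0 m) :=
  δ • place (δ ^ 2) 0 (spider (altColour c i) 2 2) i m m

theorem single_tl (c : Colour) (m i : ℕ) (y : NCBipart (δ ^ 2) 0 m) :
    (Pi.single m (tl δ c m i y) : Family (δ ^ 2) 0) =
      δ • legs (δ ^ 2) 0 (altColour c i) 2 2 i (Pi.single m y) := by
  rw [tl, LinearMap.smul_apply, Family.single_smul, single_place _ rfl]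

theorem commute_tl_of_le (c c' : Colour) (m : ℕ) {i j : ℕ} (h : i + 2 ≤ j) :
    Commute (tl δ c m i) (tl δ c' m j) := by
  obtain ⟨j, rfl⟩ : ∃ j', j = j' + 2 := ⟨j - 2, by omega⟩
  refine LinearMap.ext fun y => Family.single_injective _ _ m ?_
  simp only [Module.End.mul_apply, single_tl, map_smul]
  congr 2
  have := act_commute (N := δ ^ 2) (k := 0) (spider (altColour c i) 2 2)
    (spider (altColour c' (j + 2)) 2 2) (by omega : i ≤ j)
  exact congrArg (fun f : Module.End ℂ (Family (δ ^ 2) 0) => f (Pi.single m y)) this.symm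

theorem isTemperleyLieb_tl (hδ : δ ≠ 0) (c : Colour) (m : ℕ) : IsTemperleyLieb (tl δ c m) δ m where
  sq i := by
    refine LinearMap.ext fun y => Family.single_injective _ _ m ?_
    simp only [Module.End.mul_apply, LinearMap.smul_apply, Family.single_smul, single_tl, map_smul]
    rw [← Module.End.mul_apply, legs_two_two_sq]
  left i hi := by
    refine LinearMap.ext fun y => Family.single_injective _ _ m ?_
    have h := congrArg (fun f : Module.End ℂ (Family (δ ^ 2) 0) => f (Pi.single m y))
      (legs_braid_left (N := δ ^ 2) (k := 0) (altColour c i) i)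
    simp only [Module.End.mul_apply, LinearMap.smul_apply, act_id_single hi] at h
    simp only [Module.End.mul_apply, single_tl, map_smul, altColour_succ, h, smul_smul]
    congr 1
    field_simp
  right i hi := by
    refine LinearMap.ext fun y => Family.single_injective _ _ m ?_
    have h := congrArg (fun f : Module.End ℂ (Family (δ ^ 2) 0) => f (Pi.single m y))
      (legs_braid_right (N := δ ^ 2) (k := 0) (altColour c i).swap i)
    simp only [Module.End.mul_apply, LinearMap.smul_apply, Colour.swap_swap] at h
    simp only [Module.End.mul_apply, single_tl, map_smul, altColour_succ, h, smul_smul]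
    congr 1
    field_simp
  comm i j h := commute_tl_of_le c c m h

/-- The two Temperley-Lieb algebras commute. At the same position this is the symmetry of the
product of a black and a white connecter, at neighbouring positions the commutation of overlapping
connecters of one colour. -/
theorem commute_tl_swap (c : Colour) (m i j : ℕ) :
    Commute (tl δ c m i) (tl δ c.swap m j) := by
  have near : ∀ c : Colour, Commute (tl δ c m i) (tl δ c.swap m (i + 1)) := by
    intro c
    refine LinearMap.ext fun y => Family.single_injective _ _ m ?_
    simp only [Module.End.mul_apply, single_tl, map_smul, altColour_succ, altColour_swap,
      Colour.swap_swap]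
    congr 2
    exact congrArg (fun f : Module.End ℂ (Family (δ ^ 2) 0) => f (Pi.single m y))
      (legs_two_two_comm _ i)
  rcases lt_trichotomy i j with h | rfl | h
  · rcases (Nat.succ_le_of_lt h).eq_or_lt with rfl | h
    · exact near c
    · exact commute_tl_of_le _ _ m h
  · refine LinearMap.ext fun y => Family.single_injective _ _ m ?_
    simp only [Module.End.mul_apply, single_tl, map_smul, altColour_swap]
    congr 2
    have h1 := legs_two_two_mul_swap (N := δ ^ 2) (k := 0) (altColour c i) i
    have h2 := legs_two_two_mul_swap (N := δ ^ 2) (k := 0) (altColour c i).swap i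
    rw [Colour.swap_swap] at h2
    exact congrArg (fun f : Module.End ℂ (Family (δ ^ 2) 0) => f (Pi.single m y))
      (h1.trans h2.symm)
  · rcases (Nat.succ_le_of_lt h).eq_or_lt with rfl | h
    · refine LinearMap.ext fun y => Family.single_injective _ _ m ?_
      simp only [Module.End.mul_apply, single_tl, map_smul, altColour_succ, altColour_swap]
      congr 2
      exact congrArg (fun f : Module.End ℂ (Family (δ ^ 2) 0) => f (Pi.single m y))
        (legs_two_two_comm _ j).symm
    · exact (commute_tl_of_le _ _ m h).symm

/-- The diagram of `n` cups side by side, as a family. -/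
noncomputable def combFamily (N : ℂ) : ℕ → Family N 0
  | 0 => unitFamily N 0
  | n + 1 => cupAct N 0 (2 * n) (combFamily N n)

/-- The morphism `0 → 2 n` given by `n` cups side by side. -/
noncomputable def comb (N : ℂ) (n : ℕ) : NCBipart N 0 (2 * n) := combFamily N n (2 * n)

theorem single_comb (N : ℂ) (n : ℕ) : Pi.single (2 * n) (comb N n) = combFamily N n := by
  induction n with
  | zero => exact congrArg (Pi.single 0) (Pi.single_eq_same (M := fun m => NCBipart N 0 m) 0 _)
  | succ n ih =>
    rw [comb, combFamily, ← ih]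
    exact (act_single _ (by omega) _).symm

/-- Insertion of a cup before the output `i`. -/
noncomputable abbrev cupMap (N : ℂ) (i n : ℕ) :
    NCBipart N 0 (2 * n) →ₗ[ℂ] NCBipart N 0 (2 * (n + 1)) :=
  place N 0 Diagram.pair.flip i (2 * n) (2 * (n + 1))

/-- The cap on the outputs `i` and `i + 1`. -/
noncomputable abbrev capMap (N : ℂ) (i n : ℕ) :
    NCBipart N 0 (2 * (n + 1)) →ₗ[ℂ] NCBipart N 0 (2 * n) :=
  place N 0 Diagram.pair i (2 * (n + 1)) (2 * n)

theorem single_cupMap (N : ℂ) (i n : ℕ) (y : NCBipart N 0 (2 * n)) :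
    (Pi.single (2 * (n + 1)) (cupMap N i n y) : Family N 0) = cupAct N 0 i (Pi.single (2 * n) y) :=
  single_place _ (by omega) y

theorem single_capMap (N : ℂ) (i n : ℕ) (y : NCBipart N 0 (2 * (n + 1))) :
    (Pi.single (2 * n) (capMap N i n y) : Family N 0) =
      capAct N 0 i (Pi.single (2 * (n + 1)) y) :=
  single_place _ (by omega) y

theorem cupMap_comb (N : ℂ) (n : ℕ) : cupMap N (2 * n) n (comb N n) = comb N (n + 1) := by
  apply Family.single_injective N 0 (2 * (n + 1))
  simp only [single_cupMap, single_comb]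
  rfl

theorem cupMap_tl (c : Colour) {n j i : ℕ} (h : i + 2 ≤ j) (y : NCBipart (δ ^ 2) 0 (2 * n)) :
    cupMap (δ ^ 2) j n (tl δ c (2 * n) i y) = tl δ c (2 * (n + 1)) i (cupMap (δ ^ 2) j n y) := by
  obtain ⟨j, rfl⟩ : ∃ j', j = j' + 2 := ⟨j - 2, by omega⟩
  apply Family.single_injective (δ ^ 2) 0 (2 * (n + 1))
  simp only [single_cupMap, single_tl, map_smul]
  congr 1
  exact congrArg (fun f : Module.End ℂ (Family (δ ^ 2) 0) => f (Pi.single (2 * n) y))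
    (act_commute (spider (altColour c i) 2 2) Diagram.pair.flip (by omega : i ≤ j))

theorem tl_cupMap (c : Colour) (n i : ℕ) (y : NCBipart (δ ^ 2) 0 (2 * n)) :
    tl δ c (2 * (n + 1)) i (cupMap (δ ^ 2) i n y) = δ • cupMap (δ ^ 2) i n y := by
  apply Family.single_injective (δ ^ 2) 0 (2 * (n + 1))
  simp only [single_cupMap, single_tl, Family.single_smul]
  congr 1
  exact congrArg (fun f : Module.End ℂ (Family (δ ^ 2) 0) => f (Pi.single (2 * n) y))
    (legs_mul_cupAct _ i)

theorem tl_comb (c : Colour) {n j : ℕ} (h : 2 * j + 2 ≤ 2 * n) :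
    tl δ c (2 * n) (2 * j) (comb (δ ^ 2) n) = δ • comb (δ ^ 2) n := by
  induction n with
  | zero => omega
  | succ n ih =>
    rw [← cupMap_comb]
    rcases (show j ≤ n by omega).eq_or_lt with rfl | hj
    · exact tl_cupMap c j _ _
    · rw [← cupMap_tl c (by omega), ih (by omega), map_smul]

/-- A cup may be moved with the help of both colours. -/
theorem cupMap_eq (hδ : δ ≠ 0) (n : ℕ) {i : ℕ} (hi : i + 1 ≤ 2 * n)
    (y : NCBipart (δ ^ 2) 0 (2 * n)) :
    cupMap (δ ^ 2) i n y = tl δ .black (2 * (n + 1)) i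
      (tl δ .white (2 * (n + 1)) i (cupMap (δ ^ 2) (i + 1) n y)) := by
  apply Family.single_injective (δ ^ 2) 0 (2 * (n + 1))
  simp only [single_cupMap, single_tl, map_smul]
  rw [show altColour .white i = (altColour .black i).swap from altColour_swap .black i]
  have h := congrArg (fun f : Module.End ℂ (Family (δ ^ 2) 0) =>
    f (cupAct _ _ (i + 1) (Pi.single (2 * n) y)))
    (legs_two_two_mul_swap (N := δ ^ 2) (k := 0) (altColour .black i) i)
  have h' := congrArg (fun f : Module.End ℂ (Family (δ ^ 2) 0) => f (Pi.single (2 * n) y))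
    (capAct_mul_cupAct_succ (N := δ ^ 2) (k := 0) i)
  simp only [Module.End.mul_apply, LinearMap.smul_apply] at h h'
  rw [h, h', act_id_single hi, smul_smul, smul_smul]
  rw [show δ * δ * (δ ^ 2)⁻¹ = 1 by field_simp, one_smul]

/-- A new cup may be created at the end and then moved into place by both Temperley-Lieb algebras.
-/
theorem cupMap_eq_chain (hδ : δ ≠ 0) (n : ℕ) {i : ℕ} (hi : i ≤ 2 * n)
    (y : NCBipart (δ ^ 2) 0 (2 * n)) :
    cupMap (δ ^ 2) i n y = chain (tl δ .black (2 * (n + 1))) i (2 * n)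
      (chain (tl δ .white (2 * (n + 1))) i (2 * n) (cupMap (δ ^ 2) (2 * n) n y)) := by
  obtain ⟨p, hp⟩ := Nat.exists_eq_add_of_le hi
  induction p generalizing i with
  | zero =>
    obtain rfl : i = 2 * n := by omega
    simp
  | succ p ih =>
    have hc : Commute (tl δ .white (2 * (n + 1)) i)
        (chain (tl δ .black (2 * (n + 1))) (i + 1) (2 * n)) :=
      commute_chain fun t _ _ => commute_tl_swap .white _ i t
    rw [cupMap_eq hδ n (by omega), ih (i := i + 1) (by omega) (by omega),
      ← Module.End.mul_apply (tl δ .white _ i), hc.eq, chain_eq_mul (by omega : i < 2 * n),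
      chain_eq_mul (by omega : i < 2 * n)]
    rfl

/-- The canonical morphism `0 → 2 n` belonging to a pair of normal forms. -/
noncomputable def pairVec (δ : ℂ) (n : ℕ) (s t : List ℕ) : NCBipart (δ ^ 2) 0 (2 * n) :=
  word (tl δ .black (2 * n)) s (word (tl δ .white (2 * n)) t (comb (δ ^ 2) n))

/-- The span of the canonical morphisms. -/
noncomputable def pairSpan (δ : ℂ) (n : ℕ) : Submodule ℂ (NCBipart (δ ^ 2) 0 (2 * n)) :=
  Submodule.span ℂ {x | ∃ s t, IsNormal s ∧ IsNormal t ∧ s.length = n ∧ t.length = n ∧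
    x = pairVec δ n s t}

theorem pairVec_mem {n : ℕ} {s t : List ℕ} (hs : IsNormal s) (ht : IsNormal t)
    (hs' : s.length = n) (ht' : t.length = n) : pairVec δ n s t ∈ pairSpan δ n :=
  Submodule.subset_span ⟨s, t, hs, ht, hs', ht', rfl⟩

/-- The arcs of the comb survive under operators commuting with the Temperley-Lieb algebra. -/
theorem tl_apply_of_commute (c : Colour) {n : ℕ} (x : Module.End ℂ (NCBipart (δ ^ 2) 0 (2 * n)))
    (h : ∀ i, Commute (tl δ c (2 * n) i) x) (j : ℕ) (hj : 2 * j + 2 ≤ 2 * n) :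
    tl δ c (2 * n) (2 * j) (x (comb (δ ^ 2) n)) = δ • x (comb (δ ^ 2) n) := by
  rw [← Module.End.mul_apply, (h _).eq, Module.End.mul_apply, tl_comb c hj, map_smul]

/-- The canonical morphisms are stable under connecters of either colour. -/
theorem tl_mem_pairSpan (hδ : δ ≠ 0) (c : Colour) {n i : ℕ} (hi : i + 2 ≤ 2 * n)
    {x : NCBipart (δ ^ 2) 0 (2 * n)} (hx : x ∈ pairSpan δ n) :
    tl δ c (2 * n) i x ∈ pairSpan δ n := by
  induction hx using Submodule.span_induction with
  | zero => rw [map_zero]; exact zero_mem _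
  | add x y _ _ hx hy => rw [map_add]; exact add_mem hx hy
  | smul a x _ hx => rw [map_smul]; exact Submodule.smul_mem _ _ hx
  | mem x hx =>
    obtain ⟨s, t, hs, ht, hs', ht', rfl⟩ := hx
    rw [pairVec]
    cases c with
    | black =>
      obtain ⟨a, s', h1, h2, h3⟩ := (isTemperleyLieb_tl hδ .black (2 * n)).exists_apply_word
        (tl_apply_of_commute .black (word (tl δ .white (2 * n)) t)
          fun i => commute_word fun j _ => commute_tl_swap .black _ i j)
        hδ hs (by omega) (k := i) (by omega)
      rw [h3]
      exact Submodule.smul_mem _ _ (pairVec_mem h1 ht (by omega) ht')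
    | white =>
      obtain ⟨a, s', h1, h2, h3⟩ := (isTemperleyLieb_tl hδ .white (2 * n)).exists_apply_word
        (fun j hj => tl_comb .white hj) hδ ht (by omega) (k := i) (by omega)
      have hc : Commute (tl δ .white (2 * n) i) (word (tl δ .black (2 * n)) s) :=
        commute_word fun j _ => commute_tl_swap .white _ i j
      rw [← Module.End.mul_apply, hc.eq, Module.End.mul_apply, h3, map_smul]
      exact Submodule.smul_mem _ _ (pairVec_mem hs h1 hs' (by omega))

theorem cupMap_pairVec {n : ℕ} {s t : List ℕ} (hs : s.length = n) (ht : t.length = n) :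
    cupMap (δ ^ 2) (2 * n) n (pairVec δ n s t) = word (tl δ .black (2 * (n + 1))) s
      (word (tl δ .white (2 * (n + 1))) t (comb (δ ^ 2) (n + 1))) := by
  rw [pairVec, map_word (e' := tl δ .black (2 * (n + 1))) _
    (fun i hi y => cupMap_tl .black (by omega) y),
    map_word (e' := tl δ .white (2 * (n + 1))) _ (fun i hi y => cupMap_tl .white (by omega) y),
    cupMap_comb]

theorem cupMap_mem_pairSpan (hδ : δ ≠ 0) {n i : ℕ} (hi : i ≤ 2 * n)
    {x : NCBipart (δ ^ 2) 0 (2 * n)} (hx : x ∈ pairSpan δ n) :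
    cupMap (δ ^ 2) i n x ∈ pairSpan δ (n + 1) := by
  induction hx using Submodule.span_induction with
  | zero => rw [map_zero]; exact zero_mem _
  | add x y _ _ hx hy => rw [map_add]; exact add_mem hx hy
  | smul a x _ hx => rw [map_smul]; exact Submodule.smul_mem _ _ hx
  | mem x hx =>
    obtain ⟨s, t, hs, ht, hs', ht', rfl⟩ := hx
    have hc : Commute (chain (tl δ .white (2 * (n + 1))) i (2 * n))
        (word (tl δ .black (2 * (n + 1))) s) :=
      commute_word fun j _ => (commute_chain fun t _ _ => commute_tl_swap .black _ j t).symm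
    obtain ⟨t', h1, h2, -, h3⟩ := (isTemperleyLieb_tl hδ .white (2 * (n + 1))).exists_chain_word
        (fun j hj => tl_comb .white hj) hδ ht (by omega) (i := i) (by omega)
    obtain ⟨s', g1, g2, -, g3⟩ := (isTemperleyLieb_tl hδ .black (2 * (n + 1))).exists_chain_word
        (tl_apply_of_commute .black (word (tl δ .white (2 * (n + 1))) t')
          fun i => commute_word fun j _ => commute_tl_swap .black _ i j)
        hδ hs (by omega) (i := i) (by omega)
    rw [cupMap_eq_chain hδ n hi, cupMap_pairVec hs' ht',
      ← Module.End.mul_apply (chain (tl δ .white _) _ _),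
      hc.eq, Module.End.mul_apply]
    rw [ht'] at h3
    rw [hs'] at g3
    rw [h3, g3]
    exact pairVec_mem g1 h1 (by omega) (by omega)

theorem capMap_tl (c : Colour) (n i : ℕ) (y : NCBipart (δ ^ 2) 0 (2 * (n + 1))) :
    capMap (δ ^ 2) i n (tl δ c (2 * (n + 1)) i y) = δ • capMap (δ ^ 2) i n y := by
  apply Family.single_injective (δ ^ 2) 0 (2 * n)
  simp only [single_capMap, single_tl, Family.single_smul, map_smul]
  congr 1
  exact congrArg (fun f : Module.End ℂ (Family (δ ^ 2) 0) => f (Pi.single (2 * (n + 1)) y))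
    (capAct_mul_legs _ i)

theorem capMap_cupMap {n i : ℕ} (hi : i ≤ 2 * n) (y : NCBipart (δ ^ 2) 0 (2 * n)) :
    capMap (δ ^ 2) i n (cupMap (δ ^ 2) i n y) = δ ^ 2 • y := by
  apply Family.single_injective (δ ^ 2) 0 (2 * n)
  simp only [single_capMap, single_cupMap, Family.single_smul]
  have := congrArg (fun f : Module.End ℂ (Family (δ ^ 2) 0) => f (Pi.single (2 * n) y))
    (capAct_mul_cupAct (N := δ ^ 2) (k := 0) i)
  simp only [Module.End.mul_apply, LinearMap.smul_apply] at this
  rw [this, act_id_single (by omega)]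

theorem capMap_mem_pairSpan (hδ : δ ≠ 0) {n i : ℕ} (hi : i ≤ 2 * n)
    {x : NCBipart (δ ^ 2) 0 (2 * (n + 1))} (hx : x ∈ pairSpan δ (n + 1)) :
    capMap (δ ^ 2) i n x ∈ pairSpan δ n := by
  induction hx using Submodule.span_induction with
  | zero => rw [map_zero]; exact zero_mem _
  | add x y _ _ hx hy => rw [map_add]; exact add_mem hx hy
  | smul a x _ hx => rw [map_smul]; exact Submodule.smul_mem _ _ hx
  | mem x hx =>
    obtain ⟨s, t, hs, ht, hs', ht', rfl⟩ := hx
    obtain ⟨b, t', h1, h2, h3⟩ :=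
      (isTemperleyLieb_tl hδ .white (2 * (n + 1))).exists_apply_word_eq_chain
        (fun j hj => tl_comb .white hj) hδ ht (by omega) (k := i) (by omega)
    obtain ⟨a, s', g1, g2, g3⟩ :=
      (isTemperleyLieb_tl hδ .black (2 * (n + 1))).exists_apply_word_eq_chain
        (tl_apply_of_commute .black (chain (tl δ .white (2 * (n + 1))) i (2 * n) *
            word (tl δ .white (2 * (n + 1))) t')
          fun i => (commute_chain fun j _ _ => commute_tl_swap .black _ i j).mul_right
            (commute_word fun j _ => commute_tl_swap .black _ i j))
        hδ hs (by omega) (k := i) (by omega)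
    have hc : Commute (tl δ .white (2 * (n + 1)) i) (word (tl δ .black (2 * (n + 1))) s) :=
      commute_word fun j _ => commute_tl_swap .white _ i j
    have hc' : Commute (chain (tl δ .white (2 * (n + 1))) i (2 * n))
        (word (tl δ .black (2 * (n + 1))) s') :=
      commute_word fun j _ => (commute_chain fun t _ _ => commute_tl_swap .black _ j t).symm
    -- the cap absorbs one generator of each algebra, which turn the vector into a cup at `i`
    have e : tl δ .black (2 * (n + 1)) i (tl δ .white (2 * (n + 1)) i (pairVec δ (n + 1) s t)) =
        (b * a) • cupMap (δ ^ 2) i n (pairVec δ n s' t') := by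
      rw [show t'.length = n by omega] at h3
      rw [show s'.length = n by omega] at g3
      rw [cupMap_eq_chain hδ n hi, cupMap_pairVec (by omega) (by omega),
        ← Module.End.mul_apply (chain (tl δ .white _) _ _), hc'.eq, Module.End.mul_apply, pairVec,
        ← Module.End.mul_apply (tl δ .white _ _), hc.eq, Module.End.mul_apply, h3, map_smul,
        map_smul, ← Module.End.mul_apply (chain (tl δ .white _) _ _), g3, smul_smul]
    have e2 := congrArg (capMap (δ ^ 2) i n) e
    rw [capMap_tl, capMap_tl, map_smul, capMap_cupMap hi, smul_smul, smul_smul] at e2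
    have e3 : capMap (δ ^ 2) i n (pairVec δ (n + 1) s t) =
        ((δ * δ)⁻¹ * (b * a * δ ^ 2)) • pairVec δ n s' t' := by
      rw [← smul_smul, ← e2, smul_smul, inv_mul_cancel₀ (mul_ne_zero hδ hδ), one_smul]
    rw [e3]
    exact Submodule.smul_mem _ _ (pairVec_mem g1 h1 (by omega) (by omega))

/-- The families whose members are combinations of canonical morphisms. -/
noncomputable def pairFamilies (δ : ℂ) : Submodule ℂ (Family (δ ^ 2) 0) where
  carrier := {x | (∀ n, x (2 * n) ∈ pairSpan δ n) ∧ ∀ m, ¬ Even m → x m = 0}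
  add_mem' := fun hx hy => ⟨fun n => add_mem (hx.1 n) (hy.1 n), fun m hm => by
    rw [Pi.add_apply, hx.2 m hm, hy.2 m hm, add_zero]⟩
  zero_mem' := ⟨fun _ => zero_mem _, fun _ _ => rfl⟩
  smul_mem' := fun a _ hx => ⟨fun n => Submodule.smul_mem _ a (hx.1 n), fun m hm => by
    rw [Pi.smul_apply, hx.2 m hm, smul_zero]⟩

/-- The families of canonical morphisms are stable under all even diagrams. -/
theorem act_mem_pairFamilies (hδ : δ ≠ 0) {p q : ℕ} {f : Diagram p q} (hf : IsEvenDiagram f) :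
    (∀ i, ∀ x ∈ pairFamilies δ, act (δ ^ 2) 0 f i x ∈ pairFamilies δ) ∧
      ∀ i, ∀ x ∈ pairFamilies δ, act (δ ^ 2) 0 f.flip i x ∈ pairFamilies δ := by
  induction hf with
  | id n =>
    have : ∀ i, ∀ x ∈ pairFamilies δ, act (δ ^ 2) 0 (Diagram.id n) i x ∈ pairFamilies δ := by
      intro i x hx
      constructor
      · intro m
        rcases lt_or_ge (2 * m) (i + n) with h | h
        · rw [act_apply_of_lt _ h]; exact zero_mem _
        · rw [act_id_apply _ h]; exact hx.1 m
      · intro m hm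
        rcases lt_or_ge m (i + n) with h | h
        · rw [act_apply_of_lt _ h]
        · rw [act_id_apply _ h]; exact hx.2 m hm
    exact ⟨this, this⟩
  | connecter c =>
    have : ∀ i, ∀ x ∈ pairFamilies δ,
        act (δ ^ 2) 0 (Diagram.spider c 2 2) i x ∈ pairFamilies δ := by
      intro i x hx
      constructor
      · intro m
        rcases lt_or_ge (2 * m) (i + 2) with h | h
        · rw [act_apply_of_lt _ h]; exact zero_mem _
        · have := Submodule.smul_mem _ δ⁻¹ (tl_mem_pairSpan hδ (altColour c i) h (hx.1 m))
          rwa [tl, altColour_altColour, LinearMap.smul_apply, smul_smul, inv_mul_cancel₀ hδ,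
            one_smul, ← act_apply_eq_place _ rfl] at this
      · intro m hm
        rw [act_apply_eq_place _ rfl, hx.2 m hm, map_zero]
    exact ⟨this, this⟩
  | pair =>
    constructor
    · intro i x hx
      constructor
      · intro m
        rcases lt_or_ge (2 * m) (i + 0) with h | h
        · rw [act_apply_of_lt _ h]; exact zero_mem _
        · rw [act_apply_eq_place (m := 2 * (m + 1)) _ (by omega)]
          exact capMap_mem_pairSpan hδ h (hx.1 (m + 1))
      · intro m hm
        rw [act_apply_eq_place (m := m + 2) (m' := m) _ rfl,
          hx.2 _ (by simpa [parity_simps] using hm), map_zero]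
    · intro i x hx
      constructor
      · intro m
        rcases lt_or_ge (2 * m) (i + 2) with h | h
        · rw [act_apply_of_lt _ h]; exact zero_mem _
        · obtain ⟨m, rfl⟩ : ∃ m', m = m' + 1 := ⟨m - 1, by omega⟩
          rw [act_apply_eq_place (m := 2 * m) _ (by omega)]
          exact cupMap_mem_pairSpan hδ (by omega) (hx.1 m)
      · intro m hm
        rcases lt_or_ge m (i + 2) with h | h
        · rw [act_apply_of_lt _ h]
        · obtain ⟨m, rfl⟩ : ∃ m', m = m' + 2 := ⟨m - 2, by omega⟩
          rw [act_apply_eq_place (m := m) _ (by omega), hx.2 _ (by simpa [parity_simps] using hm),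
            map_zero]
  | comp _ _ hf hg =>
    refine ⟨fun i x hx => ?_, fun i x hx => ?_⟩
    · rw [act_comp]; exact hg.1 i _ (hf.1 i x hx)
    · rw [Diagram.flip, act_comp]; exact hf.2 i _ (hg.2 i x hx)
  | tensor _ _ hf hg =>
    refine ⟨fun i x hx => ?_, fun i x hx => ?_⟩
    · rw [act_tensor]; exact hg.1 _ _ (hf.1 i x hx)
    · rw [Diagram.flip, act_tensor]; exact hg.2 _ _ (hf.2 i x hx)
  | flip _ hf => exact ⟨hf.2, by rw [Diagram.flip_flip]; exact hf.1⟩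

theorem unitFamily_mem (δ : ℂ) : unitFamily (δ ^ 2) 0 ∈ pairFamilies δ := by
  constructor
  · intro n
    rcases Nat.eq_zero_or_pos n with rfl | hn
    · exact Submodule.subset_span ⟨[], [], trivial, trivial, rfl, rfl, rfl⟩
    · rw [unitFamily, Pi.single_eq_of_ne (by omega)]; exact zero_mem _
  · intro m hm
    rw [unitFamily, Pi.single_eq_of_ne]
    rintro rfl
    exact hm Even.zero

/-- Every even morphism `0 → 2 n` is a combination of canonical morphisms. -/
theorem NCBipartEven_le_pairSpan (hδ : δ ≠ 0) (n : ℕ) :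
    NCBipartEven (δ ^ 2) 0 (2 * n) ≤ pairSpan δ n := by
  refine Submodule.span_le.2 ?_
  rintro _ ⟨f, hf, rfl⟩
  have := ((act_mem_pairFamilies hδ hf).1 0 _ (unitFamily_mem δ)).1 n
  rwa [act_unitFamily, Pi.single_eq_same] at this

end

/-! ### A matrix representation for the parameter sixteen -/

section

open scoped Matrix

/-- The labels of a line: a vector space with four elements, so that a closed line contributes the
factor `4 = 2 ^ 2`. -/
abbrev Label : Type := ZMod 2 × ZMod 2

/-- A labelling of `k` strings. Every string is doubled to a pair of lines. -/
abbrev State (k : ℕ) : Type := Fin k → Label × Label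

/-- The matrix unit belonging to the labels of a string; for the white spiders the two lines are
exchanged. -/
def unitMat : Colour → Label × Label → Matrix Label Label ℚ
  | .black, p => Matrix.single p.1 p.2 1
  | .white, p => Matrix.single p.2 p.1 1

/-- The product of the matrix units of a labelling. -/
def prodMat (c : Colour) {k : ℕ} (x : State k) : Matrix Label Label ℚ :=
  (List.ofFn fun i => unitMat c (x i)).prod

/-- The interpretation of diagrams by matrices indexed by labellings. A black spider becomes the
boundary of a thickened spider (the structure maps of a full matrix algebra), a white spider the
same with the two lines of every string exchanged (the structure maps of the opposite algebra). -/
def eval : {k l : ℕ} → Diagram k l → State k → State l → ℚ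
  | _, _, .id _, x, y => if x = y then 1 else 0
  | _, _, .spider c k l, x, y => 2 ^ (2 - k - l : ℤ) * (prodMat c x * (prodMat c y)ᵀ).trace
  | _, _, .comp f g, x, y => ∑ z, eval f x z * eval g z y
  | _, _, .tensor (k := k) (l := l) (k' := k') (l' := l') f g, x, y =>
    eval f (fun i => x (Fin.castAdd k' i)) (fun i => y (Fin.castAdd l' i)) *
      eval g (fun i => x (Fin.natAdd k i)) (fun i => y (Fin.natAdd l i))

theorem eval_comp {k l m : ℕ} (f : Diagram k l) (g : Diagram l m) (x : State k) (y : State m) :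
    eval (f.comp g) x y = ∑ z, eval f x z * eval g z y := rfl

theorem eval_cast {k l k' l' : ℕ} (hk : k = k') (hl : l = l') (f : Diagram k l) (x : State k')
    (y : State l') : eval (f.cast hk hl) x y =
      eval f (fun i => x (Fin.cast hk i)) (fun i => y (Fin.cast hl i)) := by
  subst hk hl; rfl

theorem trace_mul_transpose_comm (A B : Matrix Label Label ℚ) :
    (A * Bᵀ).trace = (B * Aᵀ).trace := by
  rw [← Matrix.trace_transpose, Matrix.transpose_mul, Matrix.transpose_transpose]

/-- Reflection is transposition. -/
theorem eval_flip {k l : ℕ} (f : Diagram k l) (x : State k) (y : State l) :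
    eval f.flip y x = eval f x y := by
  induction f with
  | id n => simp only [Diagram.flip, eval, eq_comm]
  | spider c k l =>
    simp only [Diagram.flip, eval]
    rw [trace_mul_transpose_comm, sub_right_comm]
  | comp f g hf hg => simp only [Diagram.flip, eval, hf, hg, mul_comm]
  | tensor f g hf hg => simp only [Diagram.flip, eval, hf, hg]

theorem unitMat_white (p : Label × Label) : unitMat .white p = (unitMat .black p)ᵀ := by
  simp [unitMat]

theorem sum_unitMat_white {α : Type*} [AddCommMonoid α] (M : Matrix Label Label ℚ → α) :
    ∑ p, M (unitMat .white p) = ∑ p, M (unitMat .black p) :=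
  Equiv.sum_comp (Equiv.prodComm Label Label) fun p => M (unitMat .black p)

/-- Gluing along one string: the matrix units form an orthonormal basis for the trace form. -/
theorem sum_trace_mul_trace (c : Colour) (U V : Matrix Label Label ℚ) :
    ∑ p, (U * unitMat c p).trace * (unitMat c p * V).trace = (U * Vᵀ).trace := by
  have h : ∑ p, (U * unitMat .black p).trace * (unitMat .black p * V).trace = (U * Vᵀ).trace := by
    rw [Fintype.sum_prod_type]
    simp only [unitMat, Matrix.trace_mul_single, Matrix.trace_single_mul, MulOpposite.op_one,
      one_smul]
    rw [Finset.sum_comm]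
    simp only [Matrix.trace, Matrix.diag, Matrix.mul_apply, Matrix.transpose_apply]
  cases c
  · exact h
  · rw [sum_unitMat_white fun A => (U * A).trace * (A * V).trace, h]

theorem sum_unitMat_mul_mul (c : Colour) (B : Matrix Label Label ℚ) :
    ∑ p, unitMat c p * B * (unitMat c p)ᵀ = B.trace • (1 : Matrix Label Label ℚ) := by
  have h : ∑ p, unitMat .black p * B * (unitMat .black p)ᵀ =
      B.trace • (1 : Matrix Label Label ℚ) := by
    simp only [unitMat, Matrix.transpose_single, Matrix.single_mul_mul_single, one_mul, mul_one]
    rw [Fintype.sum_prod_type]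
    ext i j
    simp only [Matrix.sum_apply, Matrix.single_apply, Matrix.smul_apply, Matrix.one_apply,
      smul_eq_mul, mul_ite, mul_one, mul_zero, Matrix.trace, Matrix.diag]
    by_cases hij : i = j
    · subst hij; simp
    · rw [if_neg hij]
      exact Finset.sum_eq_zero fun a _ => Finset.sum_eq_zero fun b _ => if_neg (by
        rintro ⟨rfl, rfl⟩; exact hij rfl)
  cases c
  · exact h
  · rw [sum_unitMat_white fun A => A * B * Aᵀ, h]

theorem prodMat_append (c : Colour) {m n : ℕ} (x : State m) (y : State n) :
    prodMat c (Fin.append x y) = prodMat c x * prodMat c y := by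
  rw [prodMat, prodMat, prodMat, ← List.prod_append, ← List.ofFn_fin_append]
  congr 2
  funext i
  refine Fin.addCases (fun i => ?_) (fun i => ?_) i <;> simp

theorem prodMat_cons (c : Colour) {m : ℕ} (p : Label × Label) (x : State m) :
    prodMat c (Fin.cons p x : State (m + 1)) = unitMat c p * prodMat c x := by
  simp [prodMat, List.ofFn_succ]

theorem sum_state_succ {α : Type*} [AddCommMonoid α] {m : ℕ} (f : State (m + 1) → α) :
    ∑ w, f w = ∑ p, ∑ w : State m, f (Fin.cons p w) := by
  rw [← (Fin.consEquiv fun _ : Fin (m + 1) => Label × Label).sum_comp, Fintype.sum_prod_type]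
  rfl

/-- Gluing two spiders along `m + 1` strings closes `m` lines, each of which contributes the factor
`4`. -/
theorem sum_prodMat (c : Colour) (m : ℕ) (U V : Matrix Label Label ℚ) :
    ∑ w : State (m + 1), (U * (prodMat c w)ᵀ).trace * (prodMat c w * V).trace =
      4 ^ m * (U * V).trace := by
  have flip : ∀ A B : Matrix Label Label ℚ, (A * Bᵀ).trace = (Aᵀ * B).trace := fun A B => by
    rw [trace_mul_transpose_comm, Matrix.trace_mul_comm]
  induction m generalizing U V with
  | zero =>
    rw [pow_zero, one_mul, sum_state_succ]
    simp only [prodMat_cons, flip]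
    have : ∀ z : State 0, prodMat c z = 1 := fun z => rfl
    simp only [this, mul_one, Fintype.sum_unique]
    rw [sum_trace_mul_trace, flip, Matrix.transpose_transpose]
  | succ m ih =>
    rw [sum_state_succ]
    have h : ∀ p : Label × Label, ∑ w : State (m + 1),
        (U * (prodMat c (Fin.cons p w : State (m + 2)))ᵀ).trace *
          (prodMat c (Fin.cons p w : State (m + 2)) * V).trace =
        4 ^ m * (unitMat c p * 1 * (unitMat c p)ᵀ * (U * V)).trace := by
      intro p
      have h1 : (unitMat c p * 1 * (unitMat c p)ᵀ * (U * V)).trace =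
          (((unitMat c p)ᵀ * U) * (V * unitMat c p)).trace := by
        rw [mul_one, mul_assoc, Matrix.trace_mul_comm]
        simp only [mul_assoc]
      rw [h1, ← ih ((unitMat c p)ᵀ * U) (V * unitMat c p)]
      refine Finset.sum_congr rfl fun w _ => ?_
      congr 1
      · rw [prodMat_cons, Matrix.transpose_mul, ← mul_assoc, Matrix.trace_mul_comm, mul_assoc]
      · rw [prodMat_cons, mul_assoc, Matrix.trace_mul_comm, mul_assoc]
    rw [Fintype.sum_congr _ _ h, ← Finset.mul_sum, ← Matrix.trace_sum, ← Finset.sum_mul,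
      sum_unitMat_mul_mul, Matrix.trace_one, smul_mul_assoc, one_mul, Matrix.trace_smul]
    have : (Fintype.card Label : ℚ) = 4 := by norm_num [Label]
    rw [this, smul_eq_mul, pow_succ, mul_assoc]

theorem sum_state_add {α : Type*} [AddCommMonoid α] {m n : ℕ} (f : State (m + n) → α) :
    ∑ w, f w = ∑ u : State m, ∑ v : State n, f (Fin.append u v) := by
  rw [← (Fin.appendEquiv m n).sum_comp, Fintype.sum_prod_type]
  rfl

theorem eval_tensor_append {k l k' l' : ℕ} (f : Diagram k l) (g : Diagram k' l') (x : State k)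
    (x' : State k') (y : State l) (y' : State l') :
    eval (f.tensor g) (Fin.append x x') (Fin.append y y') = eval f x y * eval g x' y' := by
  simp [eval]

theorem exists_append {m n : ℕ} (x : State (m + n)) : ∃ u v, x = Fin.append u v :=
  ⟨fun i => x (Fin.castAdd n i), fun i => x (Fin.natAdd m i), Fin.append_castAdd_natAdd.symm⟩

theorem append_inj {m n : ℕ} {u u' : State m} {v v' : State n} :
    Fin.append u v = Fin.append u' v' ↔ u = u' ∧ v = v' := by
  rw [← Prod.mk_inj]
  exact (Fin.appendEquiv m n).injective.eq_iff (a := (u, v)) (b := (u', v'))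

theorem eval_fuse (c : Colour) (k₁ l₁ k₂ l₂ m : ℕ) (hm : 1 ≤ m) (x : State (k₁ + k₂))
    (y : State (l₁ + l₂)) :
    eval (((Diagram.id k₁).tensor (.spider c k₂ (m + l₂))).comp
      (((Diagram.spider c (k₁ + m) l₁).tensor (.id l₂)).cast (Nat.add_assoc k₁ m l₂) rfl)) x y =
    eval (.spider c (k₁ + k₂) (l₁ + l₂)) x y := by
  obtain ⟨m, rfl⟩ : ∃ m', m = m' + 1 := ⟨m - 1, by omega⟩
  obtain ⟨x₁, x₂, rfl⟩ := exists_append x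
  obtain ⟨y₁, y₂, rfl⟩ := exists_append y
  have hc : ∀ (u : State k₁) (v : State (m + 1)) (w : State l₂),
      (fun i => Fin.append u (Fin.append v w) (Fin.cast (Nat.add_assoc k₁ (m + 1) l₂) i)) =
        Fin.append (Fin.append u v) w := fun u v w => (Fin.append_assoc u v w).symm
  rw [eval_comp, sum_state_add]
  simp only [sum_state_add (m := m + 1) (n := l₂), eval_cast, hc]
  simp only [Fin.cast_eq_self, eval_tensor_append]
  simp only [eval, prodMat_append, ite_mul, one_mul, zero_mul, mul_ite, mul_one, mul_zero,
    Finset.sum_ite_eq', Finset.mem_univ, if_true]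
  rw [Finset.sum_comm]
  simp only [Finset.sum_ite_eq, Finset.mem_univ, if_true]
  have h : ∀ w : State (m + 1),
      2 ^ (2 - k₂ - (m + 1 + l₂ : ℕ) : ℤ) * (prodMat c x₂ * (prodMat c w * prodMat c y₂)ᵀ).trace *
        (2 ^ (2 - (k₁ + (m + 1) : ℕ) - l₁ : ℤ) *
          (prodMat c x₁ * prodMat c w * (prodMat c y₁)ᵀ).trace) =
      (2 ^ (2 - k₂ - (m + 1 + l₂ : ℕ) : ℤ) * 2 ^ (2 - (k₁ + (m + 1) : ℕ) - l₁ : ℤ)) *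
        (((prodMat c x₂ * (prodMat c y₂)ᵀ) * (prodMat c w)ᵀ).trace *
          (prodMat c w * ((prodMat c y₁)ᵀ * prodMat c x₁)).trace) := by
    intro w
    rw [Matrix.transpose_mul, mul_assoc (prodMat c x₁), Matrix.trace_mul_comm (prodMat c x₁)]
    simp only [mul_assoc]
    ring
  rw [Fintype.sum_congr _ _ h, ← Finset.mul_sum, sum_prodMat, ← mul_assoc]
  congr 1
  · rw [show (4 : ℚ) ^ m = 2 ^ (2 * m : ℤ) by
      rw [zpow_mul, zpow_natCast]; norm_num, ← zpow_add₀ two_ne_zero, ← zpow_add₀ two_ne_zero]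
    congr 1
    push_cast
    ring
  · rw [Matrix.transpose_mul, ← mul_assoc, Matrix.trace_mul_comm]
    simp only [mul_assoc]

/-- The double edge relation holds because the product of matrices and the opposite product are
glued with one line twisted, which leaves the separate traces. -/
theorem eval_double_edge (x : State 1) (y : State 1) :
    eval ((Diagram.spider .white 1 2).comp (.spider .black 2 1)) x y =
      16⁻¹ * eval ((Diagram.spider .white 1 0).comp (.spider .black 0 1)) x y := by
  have h1 : ∀ (c : Colour) (z : State 1), prodMat c z = unitMat c (z 0) := fun c z => by
    simp [prodMat]
  have h0 : ∀ (c : Colour) (z : State 0), prodMat c z = 1 := fun c z => rfl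
  obtain ⟨A, hA⟩ : ∃ A, A = unitMat .black (x 0) := ⟨_, rfl⟩
  obtain ⟨B, hB⟩ : ∃ B, B = unitMat .black (y 0) := ⟨_, rfl⟩
  have key : ∑ p, ∑ q, (Aᵀ * ((unitMat .white p) * (unitMat .white q))ᵀ).trace *
      (unitMat .black p * unitMat .black q * Bᵀ).trace = A.trace * B.trace := by
    have h : ∀ q, ∑ p, (Aᵀ * ((unitMat .white p) * (unitMat .white q))ᵀ).trace *
        (unitMat .black p * unitMat .black q * Bᵀ).trace =
        (Aᵀ * (unitMat .black q * B * (unitMat .black q)ᵀ)).trace := by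
      intro q
      have := sum_trace_mul_trace .black (Aᵀ * unitMat .black q) (unitMat .black q * Bᵀ)
      simp only [Matrix.transpose_mul, Matrix.transpose_transpose, unitMat_white,
        mul_assoc] at this ⊢
      exact this
    rw [Finset.sum_comm, Fintype.sum_congr _ _ h, ← Matrix.trace_sum, ← Finset.mul_sum,
      sum_unitMat_mul_mul, mul_smul_comm, mul_one, Matrix.trace_smul, Matrix.trace_transpose,
      smul_eq_mul, mul_comm]
  rw [eval_comp, eval_comp]
  simp only [sum_state_succ, eval, prodMat_cons, h1, h0, Fintype.sum_unique]
  rw [unitMat_white (x 0), ← hA, ← hB, Matrix.transpose_one, mul_one, one_mul,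
    Matrix.trace_transpose, Matrix.trace_transpose]
  have h : ∀ p q, 2 ^ (2 - (1 : ℕ) - (2 : ℕ) : ℤ) *
        (Aᵀ * ((unitMat .white p) * (unitMat .white q))ᵀ).trace *
      (2 ^ (2 - (2 : ℕ) - (1 : ℕ) : ℤ) * (unitMat .black p * unitMat .black q * Bᵀ).trace) =
      4⁻¹ * ((Aᵀ * ((unitMat .white p) * (unitMat .white q))ᵀ).trace *
      (unitMat .black p * unitMat .black q * Bᵀ).trace) := by
    intro p q
    norm_num
    ring
  simp only [h, ← Finset.mul_sum]
  refine (congrArg (4⁻¹ * ·) key).trans ?_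
  norm_num
  ring

/-- The interpretation satisfies the relations, with the parameter `16`. -/
theorem eval_rel {N : ℂ} {k l : ℕ} {a : ℂ} {f g : Diagram k l} (h : Rel N a f g) :
    ∃ j : ℤ, a = N ^ j ∧ ∀ x y, eval f x y = 16 ^ j * eval g x y := by
  have one : ∀ {k l : ℕ} {f g : Diagram k l}, (∀ x y, eval f x y = eval g x y) →
      ∃ j : ℤ, (1 : ℂ) = N ^ j ∧ ∀ x y, eval f x y = 16 ^ j * eval g x y := fun h =>
    ⟨0, by simp, fun x y => by rw [h, zpow_zero, one_mul]⟩
  induction h with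
  | id_comp f => exact one fun x y => by simp [eval]
  | comp_id f => exact one fun x y => by simp [eval]
  | comp_assoc f g h =>
    refine one fun x y => ?_
    simp only [eval, Finset.sum_mul, Finset.mul_sum]
    rw [Finset.sum_comm]
    simp only [mul_assoc]
  | id_tensor_id m n =>
    refine one fun x y => ?_
    obtain ⟨x₁, x₂, rfl⟩ := exists_append x
    obtain ⟨y₁, y₂, rfl⟩ := exists_append y
    rw [eval_tensor_append]
    simp only [eval, append_inj, ite_and]
    split_ifs <;> simp
  | interchange f g f' g' =>
    refine one fun x y => ?_
    obtain ⟨x₁, x₂, rfl⟩ := exists_append x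
    obtain ⟨y₁, y₂, rfl⟩ := exists_append y
    rw [eval_tensor_append, eval, eval, eval, sum_state_add]
    simp only [eval_tensor_append, Finset.sum_mul_sum]
    exact Finset.sum_congr rfl fun _ _ => Finset.sum_congr rfl fun _ _ => by ring
  | tensor_assoc f g h =>
    refine one fun x y => ?_
    obtain ⟨x₁, x₂, rfl⟩ := exists_append x
    obtain ⟨y₁, y₂, rfl⟩ := exists_append y
    obtain ⟨x₂, x₃, rfl⟩ := exists_append x₂
    obtain ⟨y₂, y₃, rfl⟩ := exists_append y₂
    rw [eval_cast, eval_tensor_append, eval_tensor_append, ← mul_assoc, ← eval_tensor_append,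
      ← eval_tensor_append, Fin.append_assoc, Fin.append_assoc]
    rfl
  | unit_tensor f =>
    refine one fun x y => ?_
    rw [eval_cast, eval, eval, if_pos (Subsingleton.elim _ _), one_mul]
    congr 1 <;> funext i <;> congr 1 <;> ext <;> simp
  | tensor_unit f =>
    refine one fun x y => ?_
    rw [eval_cast, eval, eval, if_pos (Subsingleton.elim _ _), mul_one]
    rfl
  | isolated c =>
    refine ⟨1, by simp, fun x y => ?_⟩
    simp [eval, prodMat, Subsingleton.elim x y]
    norm_num
  | string c =>
    refine one fun x y => ?_
    have hx : prodMat c x = unitMat c (x 0) := by simp [prodMat]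
    have hy : prodMat c y = unitMat c (y 0) := by simp [prodMat]
    have hxy : x = y ↔ x 0 = y 0 := by rw [funext_iff, Fin.forall_fin_one]
    simp only [eval, hx, hy, hxy]
    cases c <;> simp [unitMat, Matrix.trace_single_mul, Matrix.single_apply, Prod.ext_iff, and_comm,
      eq_comm]
  | fuse c k₁ l₁ k₂ l₂ m hm => exact one fun x y => eval_fuse c k₁ l₁ k₂ l₂ m hm x y
  | pair =>
    refine one fun x y => ?_
    have h : ∀ z : State 0, ∀ c, prodMat c z = 1 := fun z c => rfl
    simp only [eval, h]
    simp only [prodMat, List.ofFn_succ, List.ofFn_zero, List.prod_cons, List.prod_nil, mul_one,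
      unitMat_white, Matrix.transpose_one]
    rw [← Matrix.transpose_mul, Matrix.trace_transpose, Matrix.trace_mul_comm]
  | double_edge => exact ⟨-1, by simp, fun x y => by rw [eval_double_edge, zpow_neg_one]⟩
  | flip _ ih =>
    obtain ⟨j, h1, h2⟩ := ih
    exact ⟨j, h1, fun x y => by rw [eval_flip, eval_flip, h2]⟩
  | comp_left g _ ih =>
    obtain ⟨j, h1, h2⟩ := ih
    exact ⟨j, h1, fun x y => by simp only [eval, h2, Finset.mul_sum, mul_assoc]⟩
  | comp_right f _ ih =>
    obtain ⟨j, h1, h2⟩ := ih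
    exact ⟨j, h1, fun x y => by simp only [eval, h2, Finset.mul_sum, mul_left_comm]⟩
  | tensor_left g _ ih =>
    obtain ⟨j, h1, h2⟩ := ih
    exact ⟨j, h1, fun x y => by simp only [eval, h2, mul_assoc]⟩
  | tensor_right f _ ih =>
    obtain ⟨j, h1, h2⟩ := ih
    exact ⟨j, h1, fun x y => by simp only [eval, h2, mul_left_comm]⟩

end

/-! ### Supports and exponents of diagrams -/

section

open scoped Matrix Classical

section Monomial

variable {X Y Z : Type*} [AddCommGroup X] [AddCommGroup Y] [AddCommGroup Z] [Module (ZMod 2) X]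
  [Module (ZMod 2) Y] [Module (ZMod 2) Z]

/-- A matrix whose entries vanish outside of a linear relation and are equal to a fixed power of two
on this relation. -/
def IsMonomial (F : X → Y → ℚ) : Prop :=
  ∃ (e : ℤ) (S : Submodule (ZMod 2) (X × Y)), ∀ x y, F x y = if (x, y) ∈ S then 2 ^ e else 0

theorem IsMonomial.transpose {F : X → Y → ℚ} (h : IsMonomial F) : IsMonomial fun y x => F x y := by
  obtain ⟨e, S, h⟩ := h
  exact ⟨e, S.comap (LinearMap.prod (LinearMap.snd _ _ _) (LinearMap.fst _ _ _)), fun y x => h x y⟩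

/-- Composition of monomial matrices. The fibres over the points of the composite relation are
translates of one subspace, whose cardinality is a power of two. -/
theorem IsMonomial.comp [Fintype Y] {F : X → Y → ℚ} {G : Y → Z → ℚ} (hF : IsMonomial F)
    (hG : IsMonomial G) : IsMonomial fun x z => ∑ y, F x y * G y z := by
  obtain ⟨e, S, hF⟩ := hF
  obtain ⟨e', T, hG⟩ := hG
  let H : Submodule (ZMod 2) Y := S.comap (LinearMap.inr _ _ _) ⊓ T.comap (LinearMap.inl _ _ _)
  have hH : ∀ y, y ∈ H ↔ ((0 : X), y) ∈ S ∧ (y, (0 : Z)) ∈ T := fun y => Iff.rfl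
  let R : Submodule (ZMod 2) (X × Z) :=
    { carrier := {p | ∃ y, (p.1, y) ∈ S ∧ (y, p.2) ∈ T}
      add_mem' := by
        rintro _ _ ⟨y, h1, h2⟩ ⟨y', h3, h4⟩
        exact ⟨y + y', S.add_mem h1 h3, T.add_mem h2 h4⟩
      zero_mem' := ⟨0, S.zero_mem, T.zero_mem⟩
      smul_mem' := by
        rintro a _ ⟨y, h1, h2⟩
        exact ⟨a • y, S.smul_mem a h1, T.smul_mem a h2⟩ }
  have hR : ∀ x z, (x, z) ∈ R ↔ ∃ y, (x, y) ∈ S ∧ (y, z) ∈ T := fun x z => Iff.rfl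
  refine ⟨e + e' + Module.finrank (ZMod 2) H, R, fun x z => ?_⟩
  have hsum : ∑ y, F x y * G y z =
      (Fintype.card {y // (x, y) ∈ S ∧ (y, z) ∈ T} : ℚ) * 2 ^ (e + e') := by
    have : ∀ y, F x y * G y z = if (x, y) ∈ S ∧ (y, z) ∈ T then (2 : ℚ) ^ (e + e') else 0 := by
      intro y
      rw [hF, hG, ite_and, zpow_add₀ two_ne_zero]
      split_ifs <;> simp
    rw [Fintype.sum_congr _ _ this, ← Finset.sum_filter, Finset.sum_const, nsmul_eq_mul,
      Fintype.card_subtype]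
  change ∑ y, F x y * G y z = _
  rw [hsum]
  split_ifs with h
  · obtain ⟨y₀, h1, h2⟩ := (hR x z).1 h
    have hcard : Fintype.card {y // (x, y) ∈ S ∧ (y, z) ∈ T} = Fintype.card H := by
      refine Fintype.card_congr ⟨fun y => ⟨y.1 - y₀, ?_⟩, fun y => ⟨y.1 + y₀, ?_⟩, ?_, ?_⟩
      · refine (hH _).2 ⟨?_, ?_⟩
        · simpa using S.sub_mem y.2.1 h1
        · simpa using T.sub_mem y.2.2 h2
      · have := (hH _).1 y.2
        exact ⟨by simpa using S.add_mem this.1 h1, by simpa using T.add_mem this.2 h2⟩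
      · intro y; simp
      · intro y; simp
    rw [hcard, Module.card_eq_pow_finrank (K := ZMod 2), ZMod.card, zpow_add₀ two_ne_zero (e + e'),
      mul_comm]
    simp
  · have : IsEmpty {y // (x, y) ∈ S ∧ (y, z) ∈ T} := ⟨fun y => h ((hR x z).2 ⟨y.1, y.2⟩)⟩
    simp

theorem IsMonomial.smul {F : X → Y → ℚ} (h : IsMonomial F) (n : ℤ) :
    IsMonomial fun x y => 2 ^ n * F x y := by
  obtain ⟨e, S, h⟩ := h
  refine ⟨n + e, S, fun x y => ?_⟩
  beta_reduce
  rw [h, zpow_add₀ two_ne_zero]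
  split_ifs <;> simp

theorem IsMonomial.comp_linear {X' Y' : Type*} [AddCommGroup X'] [AddCommGroup Y']
    [Module (ZMod 2) X'] [Module (ZMod 2) Y'] {F : X → Y → ℚ} (h : IsMonomial F)
    (f : X' →ₗ[ZMod 2] X) (g : Y' →ₗ[ZMod 2] Y) : IsMonomial fun x y => F (f x) (g y) := by
  obtain ⟨e, S, h⟩ := h
  exact ⟨e, S.comap (f.prodMap g), fun x y => h _ _⟩

theorem IsMonomial.mul {F G : X → Y → ℚ} (hF : IsMonomial F) (hG : IsMonomial G) :
    IsMonomial fun x y => F x y * G x y := by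
  obtain ⟨e, S, hF⟩ := hF
  obtain ⟨e', T, hG⟩ := hG
  refine ⟨e + e', S ⊓ T, fun x y => ?_⟩
  have hmem : (x, y) ∈ S ⊓ T ↔ (x, y) ∈ S ∧ (x, y) ∈ T := Iff.rfl
  rw [if_congr hmem rfl rfl, zpow_add₀ two_ne_zero]
  by_cases h1 : (x, y) ∈ S <;> by_cases h2 : (x, y) ∈ T <;> simp [hF, hG, h1, h2]

theorem isMonomial_id [DecidableEq X] : IsMonomial fun x y : X => if x = y then (1 : ℚ) else 0 := by
  refine ⟨0, LinearMap.ker (LinearMap.fst (ZMod 2) X X - LinearMap.snd (ZMod 2) X X), fun x y => ?_⟩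
  simp [sub_eq_zero]

end Monomial

/-- The entries of a product of matrix units are `0` or `1`, and are `1` if and only if consecutive
labels agree. -/
theorem isMonomial_prodMat (c : Colour) (k : ℕ) :
    IsMonomial fun (x : State k) (p : Label × Label) => prodMat c x p.1 p.2 := by
  induction k with
  | zero =>
    refine ⟨0, LinearMap.ker ((LinearMap.fst (ZMod 2) Label Label -
      LinearMap.snd (ZMod 2) Label Label) ∘ₗ LinearMap.snd (ZMod 2) _ _), fun x p => ?_⟩
    have : prodMat c x = 1 := rfl
    simp [this, Matrix.one_apply, sub_eq_zero]
  | succ k ih =>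
    obtain ⟨e, S, ih⟩ := ih
    -- the linear map exchanging the lines of a string in the white case
    obtain ⟨σ, hσ⟩ : ∃ σ : Label × Label →ₗ[ZMod 2] Label × Label,
        ∀ p, unitMat c p = Matrix.single (σ p).1 (σ p).2 1 := by
      cases c
      · exact ⟨LinearMap.id, fun p => rfl⟩
      · exact ⟨(LinearMap.snd _ _ _).prod (LinearMap.fst _ _ _), fun p => rfl⟩
    let head : State (k + 1) × (Label × Label) →ₗ[ZMod 2] Label × Label :=
      σ ∘ₗ LinearMap.proj (0 : Fin (k + 1)) ∘ₗ LinearMap.fst _ _ _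
    let R : Submodule (ZMod 2) (State (k + 1) × (Label × Label)) :=
      LinearMap.ker (LinearMap.fst _ _ _ ∘ₗ head - LinearMap.fst _ _ _ ∘ₗ LinearMap.snd _ _ _) ⊓
        S.comap ((LinearMap.funLeft (ZMod 2) (Label × Label) Fin.succ ∘ₗ LinearMap.fst _ _ _).prod
          ((LinearMap.snd _ _ _ ∘ₗ head).prod (LinearMap.snd _ _ _ ∘ₗ LinearMap.snd _ _ _)))
    have hR : ∀ x p, (x, p) ∈ R ↔ (σ (x 0)).1 = p.1 ∧
        ((fun i : Fin k => x i.succ), ((σ (x 0)).2, p.2)) ∈ S := by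
      intro x p
      rw [Submodule.mem_inf, LinearMap.mem_ker, LinearMap.sub_apply, sub_eq_zero]
      rfl
    refine ⟨e, R, fun x p => ?_⟩
    obtain ⟨q, w, rfl⟩ : ∃ q w, x = Fin.cons q w :=
      ⟨x 0, fun i => x i.succ, (Fin.cons_self_tail x).symm⟩
    obtain ⟨i, j⟩ := p
    have hw : prodMat c w (σ q).2 j = if (w, ((σ q).2, j)) ∈ S then 2 ^ e else 0 :=
      ih w ((σ q).2, j)
    have hR' : ((Fin.cons q w : State (k + 1)), (i, j)) ∈ R ↔
        (σ q).1 = i ∧ (w, ((σ q).2, j)) ∈ S := hR _ _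
    change prodMat c (Fin.cons q w : State (k + 1)) i j = _
    rw [prodMat_cons, hσ, if_congr hR' rfl rfl, ite_and, ← hw]
    split_ifs with hi
    · rw [← hi, Matrix.single_mul_apply_same, one_mul]
    · exact Matrix.single_mul_apply_of_ne _ _ _ _ _ (Ne.symm hi) _

theorem isMonomial_eval {k l : ℕ} (f : Diagram k l) : IsMonomial (eval f) := by
  induction f with
  | id n => exact isMonomial_id (X := State n)
  | spider c k l =>
    have h := ((isMonomial_prodMat c k).comp (isMonomial_prodMat c l).transpose).smul (2 - k - l)
    have h2 : (fun (x : State k) (y : State l) => (2 : ℚ) ^ (2 - k - l : ℤ) *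
        ∑ p : Label × Label, prodMat c x p.1 p.2 * prodMat c y p.1 p.2) = eval (.spider c k l) := by
      funext x y
      rw [eval, Fintype.sum_prod_type]
      rfl
    rwa [h2] at h
  | comp f g hf hg => exact hf.comp hg
  | tensor f g hf hg =>
    exact (hf.comp_linear (LinearMap.funLeft (ZMod 2) _ (Fin.castAdd _))
      (LinearMap.funLeft (ZMod 2) _ (Fin.castAdd _))).mul
      (hg.comp_linear (LinearMap.funLeft (ZMod 2) _ (Fin.natAdd _))
        (LinearMap.funLeft (ZMod 2) _ (Fin.natAdd _)))

/-- The support of the interpretation of a diagram. -/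
def support {k l : ℕ} (f : Diagram k l) : Set (State k × State l) := {p | eval f p.1 p.2 ≠ 0}

theorem exists_exponent {k l : ℕ} (f : Diagram k l) : ∃ e : ℤ, eval f 0 0 = 2 ^ e := by
  obtain ⟨e, S, h⟩ := isMonomial_eval f
  exact ⟨e, by rw [h, if_pos]; exact S.zero_mem⟩

/-- The exponent of the power of two that is the value of the entries in the support of the
interpretation of a diagram. -/
noncomputable def exponent {k l : ℕ} (f : Diagram k l) : ℤ := (exists_exponent f).choose

theorem eval_zero {k l : ℕ} (f : Diagram k l) : eval f 0 0 = 2 ^ exponent f :=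
  (exists_exponent f).choose_spec

theorem eval_nonneg {k l : ℕ} (f : Diagram k l) (x : State k) (y : State l) : 0 ≤ eval f x y := by
  obtain ⟨e, S, h⟩ := isMonomial_eval f
  rw [h]
  split_ifs <;> positivity

/-- The linear map remembering the support of a diagram and its exponent, the latter with a fourth
root `ε` of the parameter in place of `2`. This turns the interpretation for the parameter `16` into
one for an arbitrary parameter. -/
noncomputable def supportMap {N ε : ℂ} (hε : ε ^ 4 = N) (hN : N ≠ 0) (k l : ℕ) :
    NCBipart N k l →ₗ[ℂ] (Set (State k × State l) →₀ ℂ) :=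
  NCBipart.lift (fun f => Finsupp.single (support f) (ε ^ exponent f)) (by
    intro a f g h
    obtain ⟨j, rfl, hj⟩ := eval_rel h
    have hs : support f = support g := by
      ext p
      have : (16 : ℚ) ^ j ≠ 0 := zpow_ne_zero _ (by norm_num)
      simp [support, hj, this]
    have he : exponent f = 4 * j + exponent g := by
      have := hj 0 0
      rw [eval_zero, eval_zero, show (16 : ℚ) = 2 ^ (4 : ℤ) by norm_num, ← zpow_mul,
        ← zpow_add₀ two_ne_zero] at this
      exact zpow_right_injective₀ (by norm_num) (by norm_num) this
    have hε0 : ε ≠ 0 := by rintro rfl; simp [eq_comm] at hε; exact hN hε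
    rw [hs, he, Finsupp.smul_single, smul_eq_mul, zpow_add₀ hε0, zpow_mul, ← hε]
    norm_cast)

@[simp]
theorem supportMap_of {N ε : ℂ} (hε : ε ^ 4 = N) (hN : N ≠ 0) {k l : ℕ} (f : Diagram k l) :
    supportMap hε hN k l (NCBipart.of N f) = Finsupp.single (support f) (ε ^ exponent f) :=
  NCBipart.lift_of _ _ _

end

/-! ### Labellings compatible with a noncrossing pairing -/

/-- The sequence `a` with the entries at `i` and `i + 1` removed. -/
def removeTwo {α : Type*} (i : ℕ) (a : ℕ → α) : ℕ → α := fun j => if j < i then a j else a (j + 2)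

/-- The sequence `a` with two entries `x` inserted at `i` and `i + 1`. -/
def insertTwo {α : Type*} (i : ℕ) (x : α) (a : ℕ → α) : ℕ → α :=
  fun j => if j < i then a j else if j < i + 2 then x else a (j - 2)

theorem removeTwo_insertTwo {α : Type*} (i : ℕ) (x : α) (a : ℕ → α) :
    removeTwo i (insertTwo i x a) = a := by
  funext j
  rw [removeTwo, insertTwo, insertTwo]
  split_ifs <;> first | rfl | omega

/-- The labelling `a` is constant on the arcs of the noncrossing pairing given by a list. -/
def Compatible : List ℕ → (ℕ → Label) → Prop
  | [], _ => True
  | i :: s, a => a i = a (i + 1) ∧ Compatible s (removeTwo i a)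

theorem compatible_cons_insertTwo (i : ℕ) (s : List ℕ) (x : Label) (a : ℕ → Label) :
    Compatible (i :: s) (insertTwo i x a) ↔ Compatible s a := by
  rw [Compatible, removeTwo_insertTwo]
  simp [insertTwo]

theorem compatible_const (s : List ℕ) (x : Label) : Compatible s fun _ => x := by
  induction s with
  | nil => trivial
  | cons i s ih =>
    refine ⟨rfl, ?_⟩
    have : removeTwo i (fun _ : ℕ => x) = fun _ => x := by funext j; simp [removeTwo]
    rwa [this]

/-- Compatibility with a list of length `n` concerns only the first `2 n` labels. -/
theorem compatible_congr {s : List ℕ} (hs : IsNormal s) {a b : ℕ → Label}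
    (h : ∀ j < 2 * s.length, a j = b j) : Compatible s a ↔ Compatible s b := by
  induction s generalizing a b with
  | nil => exact Iff.rfl
  | cons i s ih =>
    rw [List.length_cons] at h
    have hi : i ≤ s.length := hs.1.trans hs.2.height_le
    rw [Compatible, Compatible, h i (by omega), h (i + 1) (by omega), ih hs.2]
    intro j hj
    rw [removeTwo, removeTwo, h j (by omega), h (j + 2) (by omega)]

/-- There is no innermost arc to the left of the first letter of a normal form. -/
theorem exists_compatible_ne {i j : ℕ} {s : List ℕ} (hs : IsNormal (j :: s)) (hij : i < j) :
    ∃ a, Compatible (j :: s) a ∧ a i ≠ a (i + 1) := by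
  induction s generalizing i j with
  | nil => exact absurd hs.1 (by simp only [height]; omega)
  | cons k s ih =>
    rcases (Nat.succ_le_of_lt hij).eq_or_lt with rfl | hlt
    · refine ⟨insertTwo (i + 1) (1, 1) fun _ => 0,
        (compatible_cons_insertTwo _ _ _ _).2 (compatible_const _ _), ?_⟩
      have : ¬ (0 : Label) = (1, 1) := by decide
      simp [insertTwo, this]
    · have hk : j ≤ k + 1 := hs.1
      obtain ⟨a, h1, h2⟩ := ih hs.2 (i := i) (by omega)
      refine ⟨insertTwo j 0 a, (compatible_cons_insertTwo _ _ _ _).2 h1, ?_⟩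
      have e : i + 1 < j := hlt
      simpa [insertTwo, hij, e] using h2

/-- A normal form is determined by the labellings that are constant on the arcs. -/
theorem IsNormal.eq_of_compatible {s t : List ℕ} (hs : IsNormal s) (ht : IsNormal t)
    (hlen : s.length = t.length) (h : ∀ a, Compatible s a ↔ Compatible t a) : s = t := by
  induction s generalizing t with
  | nil => exact (List.length_eq_zero_iff.1 hlen.symm).symm
  | cons i s ih =>
    obtain _ | ⟨j, t⟩ := t
    · simp at hlen
    obtain rfl : i = j := by
      rcases lt_trichotomy i j with hij | hij | hij
      · obtain ⟨a, h1, h2⟩ := exists_compatible_ne ht hij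
        exact absurd ((h a).2 h1).1 h2
      · exact hij
      · obtain ⟨a, h1, h2⟩ := exists_compatible_ne hs hij
        exact absurd ((h a).1 h1).1 h2
    rw [ih hs.2 ht.2 (by simpa using hlen) fun a => by
      rw [← compatible_cons_insertTwo i s 0, h, compatible_cons_insertTwo]]

/-- The labels of one line of every string: the two families of lines are those on which the two
Temperley-Lieb algebras act. The sequence is continued by zero. -/
def line (c : Colour) {m : ℕ} (z : State m) (j : ℕ) : Label :=
  if h : j < m then (match altColour c j with
    | .black => (z ⟨j, h⟩).2
    | .white => (z ⟨j, h⟩).1) else 0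

theorem line_of_le (c : Colour) {m j : ℕ} (z : State m) (h : m ≤ j) : line c z j = 0 :=
  dif_neg (Nat.not_lt.2 h)

theorem line_of_black {c : Colour} {m j : ℕ} (z : State m) (h : j < m)
    (hc : altColour c j = .black) :
    line c z j = (z ⟨j, h⟩).2 := by
  simp [line, h, hc]

theorem line_of_white {c : Colour} {m j : ℕ} (z : State m) (h : j < m)
    (hc : altColour c j = .white) :
    line c z j = (z ⟨j, h⟩).1 := by
  simp [line, h, hc]

/-- The two lines of a string determine its labels. -/
theorem line_eq_iff (c : Colour) {m j : ℕ} (y z : State m) (h : j < m) :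
    z ⟨j, h⟩ = y ⟨j, h⟩ ↔ line c z j = line c y j ∧ line c.swap z j = line c.swap y j := by
  cases hc : altColour c j with
  | black =>
    have hc' : altColour c.swap j = .white := by rw [altColour_swap, hc]; rfl
    rw [line_of_black _ h hc, line_of_black _ h hc, line_of_white _ h hc', line_of_white _ h hc',
      Prod.ext_iff, and_comm]
  | white =>
    have hc' : altColour c.swap j = .black := by rw [altColour_swap, hc]; rfl
    rw [line_of_white _ h hc, line_of_white _ h hc, line_of_black _ h hc', line_of_black _ h hc',
      Prod.ext_iff]

/-- The labelling with prescribed lines. -/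
def ofLines (c : Colour) (m : ℕ) (a b : ℕ → Label) : State m := fun j =>
  match altColour c j with
  | .black => (b j, a j)
  | .white => (a j, b j)

theorem line_ofLines (c : Colour) {m j : ℕ} (a b : ℕ → Label) (h : j < m) :
    line c (ofLines c m a b) j = a j := by
  cases hc : altColour c j with
  | black => rw [line_of_black _ h hc]; simp [ofLines, hc]
  | white => rw [line_of_white _ h hc]; simp [ofLines, hc]

theorem line_swap_ofLines (c : Colour) {m j : ℕ} (a b : ℕ → Label) (h : j < m) :
    line c.swap (ofLines c m a b) j = b j := by
  cases hc : altColour c j with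
  | black => rw [line_of_white _ h (by rw [altColour_swap, hc]; rfl)]; simp [ofLines, hc]
  | white => rw [line_of_black _ h (by rw [altColour_swap, hc]; rfl)]; simp [ofLines, hc]

theorem eval_connecter_black (z y : State 2) :
    eval (.spider .black 2 2) z y ≠ 0 ↔
      (z 0).2 = (z 1).1 ∧ (y 0).2 = (y 1).1 ∧ (z 0).1 = (y 0).1 ∧ (z 1).2 = (y 1).2 := by
  have h2 : ∀ w : State 2, prodMat .black w = if (w 0).2 = (w 1).1 then
      Matrix.single (w 0).1 (w 1).2 1 else 0 := fun w => by
    have : prodMat .black w = unitMat .black (w 0) * unitMat .black (w 1) := by simp [prodMat]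
    rw [this, unitMat, unitMat]
    split_ifs with h
    · rw [h, Matrix.single_mul_single_same, one_mul]
    · rw [Matrix.single_mul_single_of_ne _ _ _ _ h]
  rw [eval, h2, h2]
  by_cases hz : (z 0).2 = (z 1).1
  · by_cases hy : (y 0).2 = (y 1).1
    · rw [if_pos hz, if_pos hy, Matrix.transpose_single, Matrix.trace_single_mul,
        Matrix.single_apply]
      simp [hz, hy, eq_comm, and_comm]
      norm_num
    · simp [hz, hy]
  · simp [hz]

theorem eval_connecter_white (z y : State 2) :
    eval (.spider .white 2 2) z y ≠ 0 ↔
      (z 0).1 = (z 1).2 ∧ (y 0).1 = (y 1).2 ∧ (z 0).2 = (y 0).2 ∧ (z 1).1 = (y 1).1 :=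
  eval_connecter_black (fun i => (z i).swap) fun i => (y i).swap

theorem eval_layer_ne_zero {p q : ℕ} (i : ℕ) (g : Diagram p q) (b : ℕ) (z : State (i + p + b))
    (y : State (i + q + b)) : eval (layer i g b) z y ≠ 0 ↔
      (∀ j (h : j < i), z ⟨j, by omega⟩ = y ⟨j, by omega⟩) ∧
      eval g (fun j => z ⟨i + j, by omega⟩) (fun j => y ⟨i + j, by omega⟩) ≠ 0 ∧
      ∀ j (h : j < b), z ⟨i + p + j, by omega⟩ = y ⟨i + q + j, by omega⟩ := by
  have h : ∀ {n : ℕ} (u v : State n), eval (.id n) u v ≠ 0 ↔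
      ∀ j (h : j < n), u ⟨j, h⟩ = v ⟨j, h⟩ := by
    intro n u v
    rw [eval, ne_eq, ite_eq_right_iff, Classical.not_imp, funext_iff, Fin.forall_iff]
    simp
  have ht : ∀ {k l k' l' : ℕ} (f : Diagram k l) (g : Diagram k' l') (x y), eval (f.tensor g) x y =
    eval f (fun i => x (Fin.castAdd k' i)) (fun i => y (Fin.castAdd l' i)) *
      eval g (fun i => x (Fin.natAdd k i)) (fun i => y (Fin.natAdd l i)) := fun _ _ _ _ => rfl
  rw [layer, ht, ht, mul_ne_zero_iff, mul_ne_zero_iff, and_assoc, h, h]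
  rfl

/-- The support of a connecter: its Temperley-Lieb algebra acts by a cap and a cup on the lines of
one kind and trivially on those of the other kind. -/
theorem eval_layer_connecter (c : Colour) (i b : ℕ) (z y : State (i + 2 + b)) :
    eval (layer i (.spider (altColour c i) 2 2) b) z y ≠ 0 ↔
      line c z i = line c z (i + 1) ∧ line c y i = line c y (i + 1) ∧
      (∀ j, line c.swap z j = line c.swap y j) ∧
      ∀ j, j ≠ i → j ≠ i + 1 → line c z j = line c y j := by
  have hspider : eval (.spider (altColour c i) 2 2) (fun j : Fin 2 => z ⟨i + j, by omega⟩)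
      (fun j : Fin 2 => y ⟨i + j, by omega⟩) ≠ 0 ↔
      line c z i = line c z (i + 1) ∧ line c y i = line c y (i + 1) ∧
      line c.swap z i = line c.swap y i ∧ line c.swap z (i + 1) = line c.swap y (i + 1) := by
    have hi : i < i + 2 + b := by omega
    have hi' : i + 1 < i + 2 + b := by omega
    have e1 : altColour c (i + 1) = (altColour c i).swap := altColour_succ c i
    have e2 : altColour c.swap i = (altColour c i).swap := altColour_swap c i
    have e3 : altColour c.swap (i + 1) = altColour c i := by
      rw [altColour_succ, altColour_swap, Colour.swap_swap]
    have E : ∀ w : State (i + 2 + b), ((w ⟨i, hi⟩).2, (w ⟨i, hi⟩).1, (w ⟨i + 1, hi'⟩).2,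
        (w ⟨i + 1, hi'⟩).1) = match altColour c i with
        | .black => (line c w i, line c.swap w i, line c.swap w (i + 1), line c w (i + 1))
        | .white => (line c.swap w i, line c w i, line c w (i + 1), line c.swap w (i + 1)) := by
      intro w
      simp only [line, hi, hi', dif_pos, e1, e2, e3]
      cases altColour c i <;> rfl
    have Ez := E z
    have Ey := E y
    clear E
    cases hc : altColour c i with
    | black =>
      simp only [hc, Prod.mk.injEq] at Ez Ey
      rw [eval_connecter_black, ← Ez.1, ← Ez.2.1, ← Ez.2.2.1, ← Ez.2.2.2, ← Ey.1, ← Ey.2.1,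
        ← Ey.2.2.1, ← Ey.2.2.2]
      rfl
    | white =>
      simp only [hc, Prod.mk.injEq] at Ez Ey
      rw [eval_connecter_white, ← Ez.1, ← Ez.2.1, ← Ez.2.2.1, ← Ez.2.2.2, ← Ey.1, ← Ey.2.1,
        ← Ey.2.2.1, ← Ey.2.2.2]
      rfl
  rw [eval_layer_ne_zero, hspider]
  constructor
  · rintro ⟨h1, ⟨h2, h3, h4, h5⟩, h6⟩
    have key : ∀ j, j ≠ i → j ≠ i + 1 → line c z j = line c y j ∧
        line c.swap z j = line c.swap y j := by
      intro j hj hj'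
      rcases lt_or_ge j (i + 2 + b) with h | h
      · refine (line_eq_iff c y z h).1 ?_
        rcases lt_or_ge j i with hji | hji
        · exact h1 j hji
        · obtain ⟨j, rfl⟩ : ∃ j', j = i + 2 + j' := ⟨j - (i + 2), by omega⟩
          exact h6 j (by omega)
      · simp only [line_of_le _ _ h, and_self]
    refine ⟨h2, h3, fun j => ?_, fun j hj hj' => (key j hj hj').1⟩
    by_cases hj : j = i
    · rw [hj, h4]
    · by_cases hj' : j = i + 1
      · rw [hj', h5]
      · exact (key j hj hj').2
  · rintro ⟨h1, h2, h3, h4⟩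
    exact ⟨fun j hj => (line_eq_iff c y z _).2 ⟨h4 j (by omega) (by omega), h3 j⟩,
      ⟨h1, h2, h3 _, h3 _⟩,
      fun j hj => (line_eq_iff c y z _).2 ⟨h4 _ (by omega) (by omega), h3 _⟩⟩

/-! ### Linear independence of the canonical morphisms -/

section

/-- The morphism `v` is a nonzero multiple of an even diagram, and a labelling is in the support of
this diagram if and only if its lines of the kind `c` satisfy `P` and its other lines satisfy `Q`.
-/
def HasLines (c : Colour) {N : ℂ} {m : ℕ} (v : NCBipart N 0 m) (P Q : (ℕ → Label) → Prop) : Prop :=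
  ∃ f : Diagram 0 m, IsEvenDiagram f ∧ ∃ a : ℂ, a ≠ 0 ∧ v = a • NCBipart.of N f ∧
    ∀ z, eval f default z ≠ 0 ↔ P (line c z) ∧ Q (line c.swap z)

theorem HasLines.swap {c : Colour} {N : ℂ} {m : ℕ} {v : NCBipart N 0 m}
    {P Q : (ℕ → Label) → Prop}
    (h : HasLines c v P Q) : HasLines c.swap v Q P := by
  obtain ⟨f, h1, a, h2, h3, h4⟩ := h
  exact ⟨f, h1, a, h2, h3, fun z => by rw [h4, Colour.swap_swap, and_comm]⟩

theorem HasLines.congr {c : Colour} {N : ℂ} {m : ℕ} {v : NCBipart N 0 m}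
    {P Q P' Q' : (ℕ → Label) → Prop} (h : HasLines c v P Q) (hP : ∀ a, P a ↔ P' a)
    (hQ : ∀ a, Q a ↔ Q' a) : HasLines c v P' Q' := by
  obtain rfl : P = P' := funext fun a => propext (hP a)
  obtain rfl : Q = Q' := funext fun a => propext (hQ a)
  exact h

/-- Since the entries are nonnegative, supports compose like relations. -/
theorem eval_comp_ne_zero {k l m : ℕ} (f : Diagram k l) (g : Diagram l m) (x : State k)
    (y : State m) : eval (f.comp g) x y ≠ 0 ↔ ∃ z, eval f x z ≠ 0 ∧ eval g z y ≠ 0 := by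
  rw [eval_comp, ne_eq,
    Finset.sum_eq_zero_iff_of_nonneg fun z _ => mul_nonneg (eval_nonneg f x z) (eval_nonneg g z y)]
  simp

variable {δ : ℂ}

/-- A Temperley-Lieb generator acts on the lines of its kind by a cap followed by a cup. -/
theorem HasLines.tl {c : Colour} (hδ : δ ≠ 0) {m i : ℕ} (hi : i + 2 ≤ m)
    {v : NCBipart (δ ^ 2) 0 m} {P Q : (ℕ → Label) → Prop} (h : HasLines c v P Q) :
    HasLines c (tl δ c m i v)
      (fun a => a i = a (i + 1) ∧ ∃ a', a' i = a' (i + 1) ∧ (∀ j, j ≠ i → j ≠ i + 1 → a' j = a j) ∧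
        P a') Q := by
  obtain ⟨b, rfl⟩ : ∃ b, m = i + 2 + b := ⟨m - (i + 2), by omega⟩
  obtain ⟨f, h1, r, h2, rfl, h4⟩ := h
  refine ⟨f.comp (layer i (.spider (altColour c i) 2 2) b),
    h1.comp (((IsEvenDiagram.id i).tensor (.connecter _)).tensor (.id b)), δ * r,
    mul_ne_zero hδ h2, ?_, fun y => ?_⟩
  · rw [map_smul, Spiders.tl, LinearMap.smul_apply, smul_comm, mul_smul]
    congr 2
    change act (δ ^ 2) 0 _ i (Pi.single _ _) _ = _
    rw [act_apply _ i b rfl rfl, Pi.single_eq_same, post_of]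
    rfl
  · rw [eval_comp_ne_zero]
    simp only [h4, eval_layer_connecter]
    constructor
    · rintro ⟨z, ⟨h5, h6⟩, h7, h8, h9, h10⟩
      have : line c.swap z = line c.swap y := funext h9
      exact ⟨⟨h8, line c z, h7, h10, h5⟩, this ▸ h6⟩
    · rintro ⟨⟨h5, a, h6, h7, h8⟩, h9⟩
      let z : State (i + 2 + b) := ofLines c _ a (line c.swap y)
      have hz : line c z = a := by
        funext j
        rcases lt_or_ge j (i + 2 + b) with h | h
        · exact line_ofLines c a _ h
        · rw [line_of_le _ _ h, h7 j (by omega) (by omega), line_of_le _ _ h]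
      have hz' : line c.swap z = line c.swap y := by
        funext j
        rcases lt_or_ge j (i + 2 + b) with h | h
        · exact line_swap_ofLines c a _ h
        · rw [line_of_le _ _ h, line_of_le _ _ h]
      refine ⟨z, ?_⟩
      rw [hz, hz']
      exact ⟨⟨h8, h9⟩, h6, h5, fun _ => rfl, h7⟩

/-- Moving an innermost arc from `m, m + 1` to `i, i + 1`. -/
theorem HasLines.chain {c : Colour} (hδ : δ ≠ 0) {n m i : ℕ} (hi : i ≤ m) (hm : m + 2 ≤ n)
    {v : NCBipart (δ ^ 2) 0 n} {g Q : (ℕ → Label) → Prop}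
    (h : HasLines c v (fun a => a m = a (m + 1) ∧ g (removeTwo m a)) Q) :
    HasLines c (chain (Spiders.tl δ c n) i m v)
      (fun a => a i = a (i + 1) ∧ g (removeTwo i a)) Q := by
  obtain ⟨p, hp⟩ := Nat.exists_eq_add_of_le hi
  induction p generalizing i with
  | zero =>
    obtain rfl : i = m := by omega
    rw [chain_self]
    exact h
  | succ p ih =>
    rw [chain_eq_mul (by omega : i < m), Module.End.mul_apply]
    refine ((ih (i := i + 1) (by omega) (by omega)).tl hδ (i := i) (by omega)).congr (fun a => ?_)
      fun _ => Iff.rfl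
    refine and_congr_right fun ha => ⟨?_, fun h => ?_⟩
    · rintro ⟨a', h1, h2, h3, h4⟩
      have : removeTwo (i + 1) a' = removeTwo i a := by
        funext j
        rw [removeTwo, removeTwo]
        split_ifs with h5 h6 h6
        · exact h2 j (by omega) (by omega)
        · obtain rfl : j = i := by omega
          rw [h1, h3, h2 _ (by omega) (by omega)]
        · omega
        · exact h2 _ (by omega) (by omega)
      rwa [this] at h4
    · -- the new lines at `i` and `i + 1` continue the line at `i + 2`
      refine ⟨fun j => if j = i ∨ j = i + 1 then a (i + 2) else a j, by simp, fun j h1 h2 => by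
        simp [h1, h2], by simp, ?_⟩
      convert h using 1
      funext j
      rw [removeTwo, removeTwo]
      split_ifs <;> first | rfl | omega | (congr 1; omega)

/-- A word replaces the first arcs of the comb by the pairing that it encodes. -/
theorem HasLines.word {c : Colour} (hδ : δ ≠ 0) {n : ℕ} {s : List ℕ} (hs : IsNormal s)
    (hsn : s.length ≤ n) {v : NCBipart (δ ^ 2) 0 (2 * n)} {Q : (ℕ → Label) → Prop}
    (h : HasLines c v (fun a => ∀ j < n, a (2 * j) = a (2 * j + 1)) Q) :
    HasLines c (word (Spiders.tl δ c (2 * n)) s v)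
      (fun a => Compatible s a ∧ ∀ j, s.length ≤ j → j < n → a (2 * j) = a (2 * j + 1)) Q := by
  induction s with
  | nil => exact h.congr (fun a => by simp [Compatible]) fun _ => Iff.rfl
  | cons i s ih =>
    rw [List.length_cons] at hsn
    have hi : i ≤ s.length := hs.1.trans hs.2.height_le
    have ih := ih hs.2 (by omega)
    have ih' := ih.congr (P' := fun a => a (2 * s.length) = a (2 * s.length + 1) ∧
      (fun b => Compatible s b ∧ ∀ j, s.length ≤ j → j + 1 < n → b (2 * j) = b (2 * j + 1))
        (removeTwo (2 * s.length) a)) (fun a => by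
      have : Compatible s (removeTwo (2 * s.length) a) ↔ Compatible s a :=
        compatible_congr hs.2 fun j hj => if_pos hj
      beta_reduce
      rw [this, and_left_comm]
      refine and_congr_right fun _ => ⟨fun h => ⟨h _ le_rfl (by omega), fun j h1 h2 => ?_⟩,
        fun h j h1 h2 => ?_⟩
      · rw [removeTwo, removeTwo, if_neg (by omega), if_neg (by omega)]
        exact h (j + 1) (by omega) h2
      · rcases h1.eq_or_lt with rfl | h1
        · exact h.1
        · obtain ⟨j, rfl⟩ : ∃ j', j = j' + 1 := ⟨j - 1, by omega⟩
          have := h.2 j (by omega) h2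
          rwa [removeTwo, removeTwo, if_neg (by omega), if_neg (by omega)] at this) fun _ => Iff.rfl
    refine (HasLines.chain hδ (i := i) (g := fun b => Compatible s b ∧
      ∀ j, s.length ≤ j → j + 1 < n → b (2 * j) = b (2 * j + 1)) (by omega) (by omega) ih').congr
      (fun a => ?_) fun _ => Iff.rfl
    rw [Compatible, List.length_cons, and_assoc]
    refine and_congr_right fun _ => and_congr_right fun _ =>
      ⟨fun h j h1 h2 => ?_, fun h j h1 h2 => ?_⟩
    · obtain ⟨j, rfl⟩ : ∃ j', j = j' + 1 := ⟨j - 1, by omega⟩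
      have := h j (by omega) h2
      rwa [removeTwo, removeTwo, if_neg (by omega), if_neg (by omega)] at this
    · rw [removeTwo, removeTwo, if_neg (by omega), if_neg (by omega)]
      exact h (j + 1) (by omega) h2

/-- The diagram consisting of `n` cups side by side. -/
def combDiagram : (n : ℕ) → Diagram 0 (2 * n)
  | 0 => .id 0
  | n + 1 => (combDiagram n).tensor Diagram.pair.flip

theorem isEvenDiagram_combDiagram (n : ℕ) : IsEvenDiagram (combDiagram n) := by
  induction n with
  | zero => exact .id 0
  | succ n ih => exact ih.tensor IsEvenDiagram.pair.flip

theorem comb_eq (N : ℂ) (n : ℕ) : comb N n = NCBipart.of N (combDiagram n) := by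
  have h : combFamily N n = act N 0 (combDiagram n) 0 (unitFamily N 0) := by
    induction n with
    | zero =>
      rw [act_unitFamily]
      rfl
    | succ n ih =>
      have e := act_tensor (N := N) (k := 0) (combDiagram n) Diagram.pair.flip 0
      rw [show act N 0 Diagram.pair.flip (0 + 2 * n) = cupAct N 0 (2 * n) by rw [zero_add]] at e
      rw [combFamily, ih]
      exact (LinearMap.congr_fun e _).symm
  rw [comb, h, act_unitFamily, Pi.single_eq_same]

theorem eval_cup_ne_zero (x : State 0) (y : State 2) :
    eval Diagram.pair.flip x y ≠ 0 ↔ (y 0).2 = (y 1).1 ∧ (y 0).1 = (y 1).2 := by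
  have h : prodMat .black y = unitMat .black (y 0) * unitMat .black (y 1) := by simp [prodMat]
  have h0 : prodMat .black x = 1 := rfl
  rw [Diagram.pair, Diagram.flip, eval, h, h0, unitMat, unitMat, one_mul, Matrix.trace_transpose]
  by_cases h1 : (y 0).2 = (y 1).1
  · rw [h1, Matrix.single_mul_single_same]
    by_cases h2 : (y 0).1 = (y 1).2
    · rw [h2, Matrix.trace_single_eq_same]; simp
    · rw [Matrix.trace_single_eq_of_ne _ _ _ h2]; simp [h2]
  · rw [Matrix.single_mul_single_of_ne _ _ _ _ h1]; simp [h1]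

theorem hasLines_comb (N : ℂ) (c : Colour) (n : ℕ) : HasLines c (comb N n)
    (fun a => ∀ j < n, a (2 * j) = a (2 * j + 1)) fun a => ∀ j < n, a (2 * j) = a (2 * j + 1) := by
  refine ⟨combDiagram n, isEvenDiagram_combDiagram n, 1, one_ne_zero,
    by rw [one_smul, comb_eq], fun z => ?_⟩
  induction n with
  | zero =>
    have : z = default := funext fun j => j.elim0
    subst this
    simp [combDiagram, eval]
  | succ n ih =>
    have hl : ∀ (c : Colour), ∀ j < 2 * n, line c (fun i : Fin (2 * n) => z (Fin.castAdd 2 i)) j =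
        line c z j := by
      intro c j hj
      have hj' : j < 2 * (n + 1) := by omega
      simp only [line, hj, hj', dif_pos]
      rfl
    have hcup : eval Diagram.pair.flip (default : State 0)
        (fun i : Fin 2 => z (Fin.natAdd (2 * n) i)) ≠ 0 ↔ line c z (2 * n) = line c z (2 * n + 1) ∧
          line c.swap z (2 * n) = line c.swap z (2 * n + 1) := by
      have h1 : 2 * n < 2 * (n + 1) := by omega
      have h2 : 2 * n + 1 < 2 * (n + 1) := by omega
      have e : ∀ c, altColour c (2 * n) = c := fun c => by simp [altColour]
      rw [eval_cup_ne_zero]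
      simp only [line, h1, h2, dif_pos, altColour_succ, e]
      cases c
      · exact Iff.rfl
      · exact and_comm
    change eval (combDiagram n) default (fun i : Fin (2 * n) => z (Fin.castAdd 2 i)) *
      eval Diagram.pair.flip (default : State 0) (fun i : Fin 2 => z (Fin.natAdd (2 * n) i)) ≠ 0 ↔ _
    rw [mul_ne_zero_iff, ih, hcup]
    have hs : ∀ c : Colour, (∀ j < n + 1, line c z (2 * j) = line c z (2 * j + 1)) ↔
        (∀ j < n, line c (fun i : Fin (2 * n) => z (Fin.castAdd 2 i)) (2 * j) =
          line c (fun i : Fin (2 * n) => z (Fin.castAdd 2 i)) (2 * j + 1)) ∧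
        line c z (2 * n) = line c z (2 * n + 1) := by
      intro c
      rw [Nat.forall_lt_succ_right]
      refine and_congr_left fun _ => forall₂_congr fun j hj => ?_
      rw [hl c _ (by omega), hl c _ (by omega)]
    exact and_and_and_comm.trans (and_congr (hs c) (hs c.swap)).symm

/-- The canonical morphisms are multiples of even diagrams, and their supports consist of the
labellings compatible with both pairings. -/
theorem hasLines_pairVec (hδ : δ ≠ 0) {n : ℕ} {s t : List ℕ} (hs : IsNormal s) (ht : IsNormal t)
    (hs' : s.length = n) (ht' : t.length = n) :
    HasLines .black (pairVec δ n s t) (Compatible s) (Compatible t) := by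
  have h := ((hasLines_comb (δ ^ 2) .white n).word hδ ht ht'.le).swap.word hδ hs hs'.le
  refine h.congr (fun a => ?_) (fun a => ?_)
  · exact and_iff_left fun j h1 h2 => absurd h2 (by omega)
  · exact and_iff_left fun j h1 h2 => absurd h2 (by omega)

theorem pairVec_mem_NCBipartEven (hδ : δ ≠ 0) {n : ℕ} {s t : List ℕ} (hs : IsNormal s)
    (ht : IsNormal t) (hs' : s.length = n) (ht' : t.length = n) :
    pairVec δ n s t ∈ NCBipartEven (δ ^ 2) 0 (2 * n) := by
  obtain ⟨f, hf, a, -, h, -⟩ := hasLines_pairVec hδ hs ht hs' ht'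
  rw [h]
  exact Submodule.smul_mem _ _ (Submodule.subset_span ⟨f, hf, rfl⟩)

/-- The normal forms of the pairings of `2 n` points. -/
abbrev NormalForm (n : ℕ) : Type := {s : List ℕ // IsNormal s ∧ s.length = n}

theorem compatible_injective {n : ℕ} {s t : NormalForm n}
    (h : ∀ a, (∀ j, 2 * n ≤ j → a j = 0) → (Compatible s.1 a ↔ Compatible t.1 a)) : s = t := by
  refine Subtype.ext (s.2.1.eq_of_compatible t.2.1 (s.2.2.trans t.2.2.symm) fun a => ?_)
  have e := h (fun j => if j < 2 * n then a j else 0) fun j hj => if_neg (by omega)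
  rwa [← compatible_congr s.2.1 (a := a), ← compatible_congr t.2.1 (a := a)] at e
  · intro j hj
    rw [t.2.2] at hj
    exact (if_pos hj).symm
  · intro j hj
    rw [s.2.2] at hj
    exact (if_pos hj).symm

/-- The canonical morphisms are linearly independent, since they have distinct supports. -/
theorem linearIndependent_pairVec (hδ : δ ≠ 0) (n : ℕ) :
    LinearIndependent ℂ fun p : NormalForm n × NormalForm n => pairVec δ n p.1.1 p.2.1 := by
  obtain ⟨ε, hε⟩ := IsAlgClosed.exists_pow_nat_eq δ (n := 2) two_pos
  have hε4 : ε ^ 4 = δ ^ 2 := by rw [← hε]; ring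
  have hε0 : ε ≠ 0 := by rintro rfl; exact hδ (by simpa using hε.symm)
  choose f hf a ha hv hsupp using fun p : NormalForm n × NormalForm n =>
    hasLines_pairVec hδ p.1.2.1 p.2.2.1 p.1.2.2 p.2.2.2
  have hinj : Function.Injective fun p => support (f p) := by
    intro p q hpq
    have h : ∀ z : State (2 * n), (Compatible p.1.1 (line .black z) ∧
        Compatible p.2.1 (line Colour.black.swap z)) ↔
        (Compatible q.1.1 (line .black z) ∧ Compatible q.2.1 (line Colour.black.swap z)) := by
      intro z
      rw [← hsupp, ← hsupp]
      exact Set.ext_iff.1 hpq (default, z)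
    have h' : ∀ a b : ℕ → Label, (∀ j, 2 * n ≤ j → a j = 0) → (∀ j, 2 * n ≤ j → b j = 0) →
        ((Compatible p.1.1 a ∧ Compatible p.2.1 b) ↔
          (Compatible q.1.1 a ∧ Compatible q.2.1 b)) := by
      intro a b ha hb
      have e1 : line .black (ofLines .black (2 * n) a b) = a := by
        funext j
        rcases lt_or_ge j (2 * n) with h | h
        · exact line_ofLines _ _ _ h
        · rw [line_of_le _ _ h, ha j h]
      have e2 : line Colour.black.swap (ofLines .black (2 * n) a b) = b := by
        funext j
        rcases lt_or_ge j (2 * n) with h | h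
        · exact line_swap_ofLines _ _ _ h
        · rw [line_of_le _ _ h, hb j h]
      have := h (ofLines .black (2 * n) a b)
      rwa [e1, e2] at this
    refine Prod.ext (compatible_injective fun a ha => ?_) (compatible_injective fun a ha => ?_)
    · have := h' a (fun _ => 0) ha fun _ _ => rfl
      simpa only [compatible_const, and_true] using this
    · have := h' (fun _ => 0) a (fun _ _ => rfl) ha
      simpa only [compatible_const, true_and] using this
  have h := ((Finsupp.linearIndependent_single_one ℂ (Set (State 0 × State (2 * n)))).comp _
    hinj).units_smul fun p =>
      Units.mk0 (a p * ε ^ exponent (f p)) (mul_ne_zero (ha p) (zpow_ne_zero _ hε0))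
  refine LinearIndependent.of_comp (supportMap hε4 (pow_ne_zero 2 hδ) 0 (2 * n)) ?_
  convert h using 1
  funext p
  rw [Function.comp_apply, hv, map_smul, supportMap_of, Finsupp.smul_single, smul_eq_mul,
    ← mul_one (a p * _), ← smul_eq_mul (a p * _), ← Finsupp.smul_single]
  rfl

end

/-! ### The number of normal forms -/

/-- The normal forms of length `n` whose height is at least `h`. -/
def normalForms (n h : ℕ) : Set (List ℕ) := {s | IsNormal s ∧ s.length = n ∧ h ≤ height s}

/-- The ballot numbers, `ballot p h` being the number of normal forms of length `h + p` whose height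
is at least `h`. -/
def ballot : ℕ → ℕ → ℕ
  | 0, _ => 1
  | p + 1, 0 => ballot p 1
  | p + 1, h + 1 => ballot p (h + 2) + ballot (p + 1) h

theorem normalForms_of_lt {n h : ℕ} (hn : n < h) : normalForms n h = ∅ := by
  refine Set.eq_empty_of_forall_notMem ?_
  rintro s ⟨h1, h2, h3⟩
  have := h1.height_le
  omega

/-- A normal form of height `h + 1` consists of the letter `h` and a normal form of height at least
`h`. -/
theorem encard_normalForms_succ (n h : ℕ) : (normalForms (n + 1) (h + 1)).encard =
    (normalForms (n + 1) (h + 2)).encard + (normalForms n h).encard := by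
  have e : normalForms (n + 1) (h + 1) =
      normalForms (n + 1) (h + 2) ∪ (fun s => h :: s) '' normalForms n h := by
    ext s
    constructor
    · rintro ⟨h1, h2, h3⟩
      rcases h3.eq_or_lt with h3 | h3
      · obtain _ | ⟨i, s⟩ := s
        · simp at h2
        · obtain rfl : h = i := Nat.succ_injective h3
          exact Or.inr ⟨s, ⟨h1.2, by simpa using h2, h1.1⟩, rfl⟩
      · exact Or.inl ⟨h1, h2, h3⟩
    · rintro (⟨h1, h2, h3⟩ | ⟨s, ⟨h1, h2, h3⟩, rfl⟩)
      · exact ⟨h1, h2, by omega⟩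
      · exact ⟨⟨h3, h1⟩, by simp [h2], le_rfl⟩
  rw [e, Set.encard_union_eq, Function.Injective.encard_image (List.cons_injective)]
  rw [Set.disjoint_left]
  rintro _ ⟨-, -, h3⟩ ⟨s, -, rfl⟩
  simp only [height] at h3
  omega

theorem encard_normalForms (p h : ℕ) : (normalForms (h + p) h).encard = ballot p h := by
  induction p generalizing h with
  | zero =>
    rw [add_zero, ballot]
    induction h with
    | zero =>
      have : normalForms 0 0 = {[]} := by
        ext s
        constructor
        · rintro ⟨-, h2, -⟩
          exact List.length_eq_zero_iff.1 h2
        · rintro rfl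
          exact ⟨trivial, rfl, le_rfl⟩
      simp [this]
    | succ h ih =>
      rw [encard_normalForms_succ, normalForms_of_lt (by omega), ih, Set.encard_empty, zero_add]
  | succ p ih =>
    induction h with
    | zero =>
      have : normalForms (0 + (p + 1)) 0 = normalForms (1 + p) 1 := by
        rw [zero_add, add_comm 1]
        ext s
        refine and_congr_right fun _ => and_congr_right fun hs => ?_
        obtain _ | ⟨i, s⟩ := s
        · simp at hs
        · simp [height]
      rw [this, ih, ballot]
    | succ h ih' =>
      rw [show h + 1 + (p + 1) = (h + (p + 1)) + 1 by omega, encard_normalForms_succ, ih', ballot,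
        show h + (p + 1) + 1 = h + 2 + p by omega, ih, Nat.cast_add]

/-- The closed form of the ballot numbers as differences of two binomial coefficients. -/
theorem ballot_succ_add_choose (p h : ℕ) :
    ballot (p + 1) h + (h + 2 * p + 2).choose p = (h + 2 * p + 2).choose (p + 1) := by
  induction p generalizing h with
  | zero =>
    induction h with
    | zero => simp [ballot]
    | succ h ih =>
      rw [ballot, ballot]
      simp at ih ⊢
      omega
  | succ p ih =>
    induction h with
    | zero =>
      rw [ballot]
      have h1 := ih 1
      have h2 := Nat.choose_succ_succ (2 * p + 3) p
      have h3 := Nat.choose_succ_succ (2 * p + 3) (p + 1)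
      have h4 : (2 * p + 3).choose (p + 2) = (2 * p + 3).choose (p + 1) :=
        Nat.choose_symm_of_eq_add (by omega)
      simp only [Nat.succ_eq_add_one] at h2 h3
      rw [show p + 1 + 1 = p + 2 from rfl] at h3 ⊢
      rw [show 1 + 2 * p + 2 = 2 * p + 3 by omega] at h1
      rw [show 0 + 2 * (p + 1) + 2 = 2 * p + 3 + 1 by omega]
      omega
    | succ h ih' =>
      rw [ballot]
      have h1 := ih (h + 2)
      have h2 := Nat.choose_succ_succ (h + 2 * p + 4) p
      have h3 := Nat.choose_succ_succ (h + 2 * p + 4) (p + 1)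
      simp only [Nat.succ_eq_add_one] at h2 h3
      rw [show h + 2 + 2 * p + 2 = h + 2 * p + 4 by omega] at h1
      rw [show h + 2 * (p + 1) + 2 = h + 2 * p + 4 by omega] at ih'
      rw [show h + 1 + 2 * (p + 1) + 2 = h + 2 * p + 4 + 1 by omega]
      omega

theorem ballot_zero_right (n : ℕ) : ballot n 0 = catalan n := by
  obtain _ | n := n
  · rw [ballot, catalan_zero]
  · have h1 := ballot_succ_add_choose n 0
    have h2 := Nat.choose_succ_right_eq (0 + 2 * n + 2) n
    have h3 := succ_mul_catalan_eq_centralBinom (n + 1)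
    rw [Nat.centralBinom_eq_two_mul_choose, show 2 * (n + 1) = 0 + 2 * n + 2 by omega] at h3
    rw [show 0 + 2 * n + 2 - n = n + 2 by omega] at h2
    have h4 : (n + 2) * ballot (n + 1) 0 = (n + 2) * catalan (n + 1) := by
      rw [h3]
      nlinarith
    exact Nat.eq_of_mul_eq_mul_left (by omega) h4

theorem mk_normalForm (n : ℕ) : Cardinal.mk (NormalForm n) = (catalan n : ℕ) := by
  have h : (normalForms n 0).encard = catalan n := by
    rw [← ballot_zero_right, ← encard_normalForms, zero_add]
  have e : {s : List ℕ | IsNormal s ∧ s.length = n} = normalForms n 0 := by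
    ext s
    simp [normalForms]
  change Cardinal.mk {s : List ℕ | IsNormal s ∧ s.length = n} = _
  rwa [← Cardinal.toENat_eq_natCast, Set.toENat_cardinalMk, e]

theorem rank_NCBipartEven_zero {δ : ℂ} (hδ : δ ≠ 0) (n : ℕ) :
    Module.rank ℂ (NCBipartEven (δ ^ 2) 0 (2 * n)) = (catalan n ^ 2 : ℕ) := by
  have e : NCBipartEven (δ ^ 2) 0 (2 * n) = Submodule.span ℂ
      (Set.range fun p : NormalForm n × NormalForm n => pairVec δ n p.1.1 p.2.1) := by
    refine le_antisymm ((NCBipartEven_le_pairSpan hδ n).trans (Submodule.span_mono ?_))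
      (Submodule.span_le.2 ?_)
    · rintro _ ⟨s, t, hs, ht, hs', ht', rfl⟩
      exact ⟨(⟨s, hs, hs'⟩, ⟨t, ht, ht'⟩), rfl⟩
    · rintro _ ⟨p, rfl⟩
      exact pairVec_mem_NCBipartEven hδ p.1.2.1 p.2.2.1 p.1.2.2 p.2.2.2
  have hli := linearIndependent_pairVec hδ n
  rw [e, rank_span hli, Cardinal.mk_range_eq _ hli.injective, Cardinal.mk_prod, mk_normalForm]
  simp [sq]

/-! ### Bending inputs into outputs -/

section

variable {N : ℂ}

theorem Rel.cast {k l k' l' : ℕ} {a : ℂ} {f g : Diagram k l} (h : Rel N a f g) (hk : k = k')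
    (hl : l = l') : Rel N a (f.cast hk hl) (g.cast hk hl) := by
  subst hk hl; exact h

theorem IsEvenDiagram.cast {k l k' l' : ℕ} {f : Diagram k l} (h : IsEvenDiagram f) (hk : k = k')
    (hl : l = l') : IsEvenDiagram (f.cast hk hl) := by
  subst hk hl; exact h

/-- The first input of a diagram bent around to become its first output. -/
def bend {k l : ℕ} (f : Diagram (k + 1) l) : Diagram k (l + 1) :=
  ((Diagram.pair.flip.tensor (.id k)).comp
    (((Diagram.id 1).tensor f).cast (by omega) rfl)).cast (Nat.zero_add k) (Nat.add_comm 1 l)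

/-- The first output of a diagram bent around to become its first input. -/
def unbend {k l : ℕ} (g : Diagram k (l + 1)) : Diagram (k + 1) l :=
  (((Diagram.id 1).tensor g).comp
    ((Diagram.pair.tensor (.id l)).cast (by omega) rfl)).cast (Nat.add_comm 1 k) (Nat.zero_add l)

theorem isEvenDiagram_bend {k l : ℕ} {f : Diagram (k + 1) l} (h : IsEvenDiagram f) :
    IsEvenDiagram (bend f) :=
  ((IsEvenDiagram.pair.flip.tensor (.id k)).comp (((IsEvenDiagram.id 1).tensor h).cast _ _)).cast
    _ _

theorem isEvenDiagram_unbend {k l : ℕ} {g : Diagram k (l + 1)} (h : IsEvenDiagram g) :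
    IsEvenDiagram (unbend g) :=
  (((IsEvenDiagram.id 1).tensor h).comp ((IsEvenDiagram.pair.tensor (.id l)).cast _ _)).cast _ _

theorem act_bend {k l k' : ℕ} (f : Diagram (k + 1) l) (i : ℕ) :
    act N k' (bend f) i = act N k' f (i + 1) * cupAct N k' i := by
  rw [bend, act_cast, act_comp, act_cast, act_tensor, act_tensor,
    act_mul_act_id f (by omega : i + 1 ≤ i + 1 + (k + 1)), ← mul_assoc,
    act_mul_act_id f (by omega : i + 2 + k ≤ i + 1 + (k + 1))]

theorem act_unbend {k l k' : ℕ} (g : Diagram k (l + 1)) (i : ℕ) :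
    act N k' (unbend g) i = capAct N k' i * act N k' g (i + 1) := by
  rw [unbend, act_cast, act_comp, act_cast, act_tensor', act_tensor',
    act_id_mul_act g (by omega : i + 1 ≤ i + 1 + (l + 1)), mul_assoc,
    act_id_mul_act g (by omega : i + 2 + l ≤ i + 1 + (l + 1))]

theorem of_eq_of_act_eq {k l : ℕ} {f g : Diagram k l} (h : act N k f 0 = act N k g 0) :
    NCBipart.of N f = NCBipart.of N g := by
  apply Family.single_injective N k l
  simp only [← act_unitFamily, h]

theorem of_unbend_bend {k l : ℕ} (f : Diagram (k + 1) l) :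
    NCBipart.of N (unbend (bend f)) = NCBipart.of N f := by
  apply of_eq_of_act_eq
  have h := act_commute (N := N) (k := k + 1) Diagram.pair f (le_refl 0)
  rw [act_unbend, act_bend, ← mul_assoc]
  refine (congrArg (· * cupAct N (k + 1) 1) h.symm).trans ?_
  rw [mul_assoc, capAct_mul_cupAct_succ 0]
  exact act_mul_act_id f (by omega)

theorem of_bend_unbend {k l : ℕ} (g : Diagram k (l + 1)) :
    NCBipart.of N (bend (unbend g)) = NCBipart.of N g := by
  apply of_eq_of_act_eq
  have h := act_commute (N := N) (k := k) Diagram.pair.flip g (le_refl 0)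
  rw [act_bend, act_unbend, mul_assoc]
  refine (congrArg (capAct N k 1 * ·) h).trans ?_
  rw [← mul_assoc, capAct_succ_mul_cupAct 0]
  exact act_id_mul_act g (by omega)

/-- Bending the first input, as a linear equivalence. -/
noncomputable def bendEquiv (N : ℂ) (k l : ℕ) : NCBipart N (k + 1) l ≃ₗ[ℂ] NCBipart N k (l + 1) :=
  LinearEquiv.ofLinearMap
    (NCBipart.lift (fun f => NCBipart.of N (bend f)) fun _ _ _ h =>
      NCBipart.of_rel ((Rel.comp_right _ ((Rel.tensor_right _ h).cast _ _)).cast _ _))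
    (NCBipart.lift (fun g => NCBipart.of N (unbend g)) fun _ _ _ h =>
      NCBipart.of_rel ((Rel.comp_left _ (Rel.tensor_right _ h)).cast _ _))
    (NCBipart.hom_ext fun g => by simp [NCBipart.lift_of, of_bend_unbend])
    (NCBipart.hom_ext fun f => by simp [NCBipart.lift_of, of_unbend_bend])

theorem bendEquiv_of {k l : ℕ} (f : Diagram (k + 1) l) :
    bendEquiv N k l (NCBipart.of N f) = NCBipart.of N (bend f) := by
  simp [bendEquiv, NCBipart.lift_of]

theorem map_bendEquiv (k l : ℕ) : (NCBipartEven N (k + 1) l).map (bendEquiv N k l).toLinearMap =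
    NCBipartEven N k (l + 1) := by
  rw [NCBipartEven, Submodule.map_span, NCBipartEven]
  congr 1
  ext x
  constructor
  · rintro ⟨_, ⟨f, hf, rfl⟩, rfl⟩
    exact ⟨bend f, isEvenDiagram_bend hf, bendEquiv_of f⟩
  · rintro ⟨g, hg, rfl⟩
    exact ⟨_, ⟨unbend g, isEvenDiagram_unbend hg, rfl⟩, (bendEquiv_of _).trans (of_bend_unbend g)⟩

/-- All inputs may be bent around to become outputs. -/
theorem rank_NCBipartEven_eq (N : ℂ) (k l : ℕ) :
    Module.rank ℂ (NCBipartEven N k l) = Module.rank ℂ (NCBipartEven N 0 (k + l)) := by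
  induction k generalizing l with
  | zero => rw [zero_add]
  | succ k ih =>
    rw [((bendEquiv N k l).submoduleMap (NCBipartEven N (k + 1) l)).rank_eq, map_bendEquiv, ih,
      show k + 1 + l = k + (l + 1) by omega]

/-- Even diagrams have an even total number of inputs and outputs. -/
theorem IsEvenDiagram.even_add {k l : ℕ} {f : Diagram k l} (h : IsEvenDiagram f) :
    Even (k + l) := by
  induction h with
  | id n => exact ⟨n, rfl⟩
  | connecter c => exact ⟨2, rfl⟩
  | pair => exact ⟨1, rfl⟩
  | comp _ _ hf hg => simp only [Nat.even_add] at *; tauto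
  | tensor _ _ hf hg => simp only [Nat.even_add] at *; tauto
  | flip _ hf => rwa [add_comm]

theorem NCBipartEven_eq_bot {k l : ℕ} (h : ¬ Even (k + l)) : NCBipartEven N k l = ⊥ := by
  rw [NCBipartEven, Submodule.span_eq_bot]
  rintro _ ⟨f, hf, -⟩
  exact absurd hf.even_add h

end

end Spiders

theorem lemmaL (δ : ℂ) (hδ : δ ≠ 0) (k l : ℕ) :
    Module.rank ℂ (Spiders.NCBipartEven (δ ^ 2) k l) =
      if Even (k + l) then ((catalan ((k + l) / 2) ^ 2 : ℕ) : Cardinal) else 0 := by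
  split_ifs with h
  · obtain ⟨n, hn⟩ := h
    rw [Spiders.rank_NCBipartEven_eq, hn, ← two_mul, Spiders.rank_NCBipartEven_zero hδ,
      Nat.mul_div_cancel_left n two_pos]
  · rw [Spiders.NCBipartEven_eq_bot h, rank_bot]
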